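/- **Theorem 3.2.** Write $v_k=\partial v/\partial x_k$, $v_{ij}=\partial^2 v/\partial x_i\partial x_j$ on $\mathbb R^4$, and set $$\begin{aligned}F(\nabla^2v,\nabla v,v)={}&v^2\big[(v_{11}+v_{33})(v_{22}+v_{44})-(v_{12}+v_{34})(v_{21}+v_{43})-(v_{14}-v_{32})(v_{41}-v_{23})\big]\\&+v\big[(v_2^2+v_4^2)(v_{11}+v_{33})+(v_1^2+v_3^2)(v_{22}+v_{44})-(v_1v_2+v_3v_4)(v_{12}+v_{34}+v_{21}+v_{43})\\&\qquad-(v_1v_4-v_2v_3)(v_{14}-v_{32}+v_{41}-v_{23})\big]-1,\end{aligned}$$ a polynomial in the sixteen variables $v_{ij}$, the four variables $v_k$ and $v$; let $F^{ij}=\partial F/\partial v_{ij}$, evaluated at $(\nabla^2v(x),\nabla v(x),v(x))$. Let $\Omega\subset\mathbb R^4$ be a domain (a nonempty connected open set, not necessarily convex), and let $v\in C^4(\Omega)$ be a solution of $F(\nabla^2v,\nabla v,v)=0$ in $\Omega$ that is convex (i.e. convex on every convex subset of $\Omega$). Put $\phi(x)=\sigma_4(\nabla^2v(x))=\det\nabla^2v(x)$.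 Suppose that the Hessian of $v$ attains its minimal rank $3$ at $x_0\in\Omega$, i.e. $\operatorname{rank}\nabla^2v(x_0)=3\le\operatorname{rank}\nabla^2v(x)$ for all $x\in\Omega$. Then there exist an open neighbourhood $\mathcal O\subset\Omega$ of $x_0$ and a constant $C>0$ such that $$\sum_{i,j=1}^4F^{ij}(x)\,\phi_{ij}(x)\le C\big(\phi(x)+|\nabla\phi(x)|\big)\qquad\text{for all }x\in\mathcal O .$$ -/

import Mathlib

noncomputable section

namespace PowerConvexity

/-- The partial derivative `∂f/∂x_i` of a real function on `ℝ⁴`. The coordinates are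
`(x₁, x₂, x₃, x₄)`, indexed by `0, 1, 2, 3 : Fin 4`. -/
def partialD (i : Fin 4) (f : EuclideanSpace ℝ (Fin 4) → ℝ) (x : EuclideanSpace ℝ (Fin 4)) : ℝ :=
  fderiv ℝ f x (EuclideanSpace.single i 1)

/-- The vector of first partial derivatives `(f_1, f_2, f_3, f_4)` at `x`. -/
def grad (f : EuclideanSpace ℝ (Fin 4) → ℝ) (x : EuclideanSpace ℝ (Fin 4)) : Fin 4 → ℝ :=
  fun i => partialD i f x

/-- The Hessian matrix `(f_{ij})` of second partial derivatives at `x`. -/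
def hess (f : EuclideanSpace ℝ (Fin 4) → ℝ) (x : EuclideanSpace ℝ (Fin 4)) :
    Matrix (Fin 4) (Fin 4) ℝ :=
  Matrix.of fun i j => partialD j (partialD i f) x

/-- The operator `F(A, p, z)`, a polynomial in the sixteen entries of `A` (the slot of `∇²v`),
the four entries of `p` (the slot of `∇v`) and `z` (the slot of `v`). -/
def F (A : Matrix (Fin 4) (Fin 4) ℝ) (p : Fin 4 → ℝ) (z : ℝ) : ℝ :=
  z ^ 2 * ((A 0 0 + A 2 2) * (A 1 1 + A 3 3) - (A 0 1 + A 2 3) * (A 1 0 + A 3 2)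
      - (A 0 3 - A 2 1) * (A 3 0 - A 1 2))
    + z * ((p 1 ^ 2 + p 3 ^ 2) * (A 0 0 + A 2 2) + (p 0 ^ 2 + p 2 ^ 2) * (A 1 1 + A 3 3)
      - (p 0 * p 1 + p 2 * p 3) * (A 0 1 + A 2 3 + A 1 0 + A 3 2)
      - (p 0 * p 3 - p 1 * p 2) * (A 0 3 - A 2 1 + A 3 0 - A 1 2))
    - 1

/-- The partial derivative of `F` in the matrix entry `(i, j)`, the sixteen entries being
independent variables. -/
def dF (i j : Fin 4) (A : Matrix (Fin 4) (Fin 4) ℝ) (p : Fin 4 → ℝ) (z : ℝ) : ℝ :=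
  deriv (fun t : ℝ => F (A + t • Matrix.single i j (1 : ℝ)) p z) 0

/-- The coefficient `F^{ij} = ∂F/∂v_{ij}` along `v`, at the point `x`. -/
def coeff (v : EuclideanSpace ℝ (Fin 4) → ℝ) (i j : Fin 4) (x : EuclideanSpace ℝ (Fin 4)) : ℝ :=
  dF i j (hess v x) (grad v x) (v x)

/-- `v` solves `F(∇²v, ∇v, v) = 0` at every point of `Ω`. -/
def IsSolution (Ω : Set (EuclideanSpace ℝ (Fin 4))) (v : EuclideanSpace ℝ (Fin 4) → ℝ) : Prop :=
  ∀ x ∈ Ω, F (hess v x) (grad v x) (v x) = 0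

/-- Convexity of a function on a domain that need not be convex itself: the function is convex on
every convex subset (equivalently, along every segment) of `Ω`. For a convex `Ω` this is
`ConvexOn ℝ Ω v`. -/
def IsConvexFunction (Ω : Set (EuclideanSpace ℝ (Fin 4))) (v : EuclideanSpace ℝ (Fin 4) → ℝ) :
    Prop :=
  ∀ K : Set (EuclideanSpace ℝ (Fin 4)), K ⊆ Ω → Convex ℝ K → ConvexOn ℝ K v

/-- `φ = σ₄(∇²v)`, the product of the four eigenvalues of the Hessian, that is `det ∇²v`. -/
def phi (v : EuclideanSpace ℝ (Fin 4) → ℝ) (x : EuclideanSpace ℝ (Fin 4)) : ℝ :=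
  (hess v x).det

end PowerConvexity

end

noncomputable section

namespace PowerConvexity

open Matrix

/-! Identify ℝ⁴ with ℂ² by z₁ = x₁ + i x₃, z₂ = x₂ + i x₄. On symmetric matrices F + 1 is the
determinant of the 2×2 Hermitian matrix M = vX + (∇v)(∇v)*, where X is the Hermitian part of the
Hessian W, and (F^{ij}) represents v·adj M. A real kernel line contains no complex line, so X is
invertible at x₀ although W is not (`hdet_herm_pos`).

Some diagonal cofactor d of W is positive at x₀ (`exists_adjugate_diag_pos`), so near x₀ one has φ =
d·s with s a Schur complement, Wξ = s·e_m and ξ_m = 1. It suffices to bound F^{ij}s_{ij} by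
multiples of s and ∇s with continuous coefficients. Now s_{ij} = ξᵀW_{ij}ξ − 2 ξ_iᵀWξ_j
(`partialD_schur`). With ξ frozen, the first term is a second directional derivative of W, which the
twice differentiated equation det M = 1 controls (`dirD_hdet_eq_zero`).

The negative term has to absorb what is left. Modulo ∇s, the matrix N of first derivatives of ξ
solves WN = −S, where S is the derivative of W along ξ. Since W may be singular, NᵀWN is bounded
below by comparison with the complex linear matrix −X⁻¹Y, where Y is the Hermitian part of S. The
trace identities and `hdet_linearization` then leave only a multiple of det D, with D = vY + (∂_ξ
v)X. The once differentiated equation says that D is orthogonal to M up to O(s), so the reversed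
Cauchy-Schwarz inequality gives det D ≤ O(s²). This is `weighted_hess_le`. -/

/-- The coordinates `(a, b, c, d)` of the Hermitian form `[[a, c - i d], [c + i d, b]]` obtained
from a real bilinear form on `ℝ⁴ = ℂ²` by averaging over the complex structure. -/
def herm (A : Matrix (Fin 4) (Fin 4) ℝ) : Fin 4 → ℝ :=
  ![A 0 0 + A 2 2, A 1 1 + A 3 3, (A 0 1 + A 1 0 + A 2 3 + A 3 2) / 2,
    (A 0 3 + A 3 0 - A 2 1 - A 1 2) / 2]

/-- The determinant of a `2 × 2` Hermitian matrix in coordinates. -/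
def hdet (m : Fin 4 → ℝ) : ℝ := m 0 * m 1 - m 2 ^ 2 - m 3 ^ 2

/-- The polarization of `hdet`, that is `tr (adj m * n)`. -/
def hpol (m n : Fin 4 → ℝ) : ℝ := m 1 * n 0 + m 0 * n 1 - 2 * (m 2 * n 2) - 2 * (m 3 * n 3)

/-- The Hermitian part of `p q*`, in coordinates. -/
def outer (p q : Fin 4 → ℝ) : Fin 4 → ℝ :=
  ![p 0 * q 0 + p 2 * q 2, p 1 * q 1 + p 3 * q 3,
    (p 0 * q 1 + p 1 * q 0 + p 2 * q 3 + p 3 * q 2) / 2,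
    (p 0 * q 3 + p 3 * q 0 - p 1 * q 2 - p 2 * q 1) / 2]

/-- The Hermitian matrix whose determinant is `F + 1`. -/
def mform (A : Matrix (Fin 4) (Fin 4) ℝ) (p : Fin 4 → ℝ) (z : ℝ) : Fin 4 → ℝ :=
  z • herm A + outer p p

/-- The real symmetric matrix representing `z • adj m`. -/
def coeffMat (z : ℝ) (m : Fin 4 → ℝ) : Matrix (Fin 4) (Fin 4) ℝ :=
  !![z * m 1, -(z * m 2), 0, -(z * m 3);
     -(z * m 2), z * m 0, z * m 3, 0;
     0, z * m 3, z * m 1, -(z * m 2);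
     -(z * m 3), 0, -(z * m 2), z * m 0]

/-- The real matrix representing `adj X * Y`. -/
def adjMulMat (X Y : Fin 4 → ℝ) : Matrix (Fin 4) (Fin 4) ℝ :=
  !![X 1 * Y 0 - X 2 * Y 2 - X 3 * Y 3, X 1 * Y 2 - X 2 * Y 1,
        -(X 3 * Y 2 - X 2 * Y 3), -(X 3 * Y 1 - X 1 * Y 3);
     X 0 * Y 2 - X 2 * Y 0, X 0 * Y 1 - X 2 * Y 2 - X 3 * Y 3,
        -(X 0 * Y 3 - X 3 * Y 0), -(X 2 * Y 3 - X 3 * Y 2);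
     X 3 * Y 2 - X 2 * Y 3, X 3 * Y 1 - X 1 * Y 3,
        X 1 * Y 0 - X 2 * Y 2 - X 3 * Y 3, X 1 * Y 2 - X 2 * Y 1;
     X 0 * Y 3 - X 3 * Y 0, X 2 * Y 3 - X 3 * Y 2,
        X 0 * Y 2 - X 2 * Y 0, X 0 * Y 1 - X 2 * Y 2 - X 3 * Y 3]

/-! ### The operator and its linearization in Hermitian form -/

lemma F_eq_hdet {A : Matrix (Fin 4) (Fin 4) ℝ} (hA : ∀ i j, A i j = A j i) (p : Fin 4 → ℝ)
    (z : ℝ) : F A p z = hdet (mform A p z) - 1 := by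
  simp only [F, hdet, mform, herm, outer, Pi.add_apply, Pi.smul_apply, smul_eq_mul,
    Matrix.cons_val]
  rw [hA 1 0, hA 3 2, hA 3 0, hA 2 1]
  ring

/-- Each of the sixteen entries enters at most one factor of each product in `F`, so `F` is affine
in every single entry. Symmetry of the base point is needed only to identify the slope. -/
lemma F_add_smul_single {A : Matrix (Fin 4) (Fin 4) ℝ} (hA : ∀ i j, A i j = A j i)
    (p : Fin 4 → ℝ) (z : ℝ) (i j : Fin 4) (t : ℝ) :
    F (A + t • Matrix.single i j (1 : ℝ)) p z
      = F A p z + t * coeffMat z (mform A p z) i j := by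
  have h10 := hA 1 0
  have h32 := hA 3 2
  have h30 := hA 3 0
  have h21 := hA 2 1
  fin_cases i <;> fin_cases j <;>
    simp [F, coeffMat, mform, herm, outer] <;>
    rw [h10, h32, h30, h21] <;> ring

lemma dF_eq_coeffMat {A : Matrix (Fin 4) (Fin 4) ℝ} (hA : ∀ i j, A i j = A j i)
    (p : Fin 4 → ℝ) (z : ℝ) (i j : Fin 4) :
    dF i j A p z = coeffMat z (mform A p z) i j := by
  unfold dF
  simp_rw [F_add_smul_single hA]
  simp

lemma sum_coeffMat_mul (z : ℝ) (m : Fin 4 → ℝ) (H : Matrix (Fin 4) (Fin 4) ℝ) :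
    ∑ i, ∑ j, coeffMat z m i j * H i j = z * hpol m (herm H) := by
  simp [Fin.sum_univ_four, coeffMat, hpol, herm]
  ring

lemma coeffMat_comm (z : ℝ) (m : Fin 4 → ℝ) (i j : Fin 4) :
    coeffMat z m i j = coeffMat z m j i := by
  fin_cases i <;> fin_cases j <;> simp [coeffMat]

/-! ### Inequalities and trace identities for Hermitian 2×2 matrices -/

/-- The reversed Cauchy-Schwarz inequality for the Lorentzian form `hdet`. -/
lemma four_mul_hdet_mul_hdet_le {m : Fin 4 → ℝ} (hm : 0 < hdet m) (n : Fin 4 → ℝ) :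
    4 * hdet m * hdet n ≤ hpol m n ^ 2 := by
  have h0 : m 0 ≠ 0 := by
    intro h
    simp only [hdet, h] at hm
    nlinarith [sq_nonneg (m 2), sq_nonneg (m 3)]
  have h1 : 0 < m 0 ^ 2 := by positivity
  have key : m 0 ^ 2 * (hpol m n ^ 2 - 4 * hdet m * hdet n)
      = (m 0 * hpol m n - 2 * hdet m * n 0) ^ 2
        + 4 * hdet m * ((m 0 * n 2 - m 2 * n 0) ^ 2 + (m 0 * n 3 - m 3 * n 0) ^ 2) := by
    simp only [hpol, hdet]
    ring
  have h2 : 0 ≤ m 0 ^ 2 * (hpol m n ^ 2 - 4 * hdet m * hdet n) := by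
    rw [key]; positivity
  have := nonneg_of_mul_nonneg_right h2 h1
  linarith

/-- Completing squares after multiplication by z·m₀. Only the sign of z·m₀ matters, so a negative z
with a negative definite m is covered too. -/
lemma coeffMat_quadratic_nonneg {z : ℝ} {m : Fin 4 → ℝ} (hz : 0 < z * m 0) (hm : 0 ≤ hdet m)
    (b : Fin 4 → ℝ) : 0 ≤ ∑ i, ∑ j, coeffMat z m i j * (b i * b j) := by
  have key : (z * m 0) * ∑ i, ∑ j, coeffMat z m i j * (b i * b j)
      = (z * (m 0 * b 1 - m 2 * b 0 + m 3 * b 2)) ^ 2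
        + (z * (m 0 * b 3 - m 2 * b 2 - m 3 * b 0)) ^ 2
        + z ^ 2 * hdet m * (b 0 ^ 2 + b 2 ^ 2) := by
    simp [Fin.sum_univ_four, coeffMat, hdet]
    ring
  have h2 : 0 ≤ (z * m 0) * ∑ i, ∑ j, coeffMat z m i j * (b i * b j) := by
    rw [key]; positivity
  exact nonneg_of_mul_nonneg_right h2 hz

-- Factor W = BᵀB; the contraction becomes the sum of the values of the quadratic form P at the rows
-- of BC.
open scoped MatrixOrder Matrix.Norms.L2Operator in
lemma sum_mul_conj_nonneg {P W : Matrix (Fin 4) (Fin 4) ℝ} (hW : W.PosSemidef)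
    (hP : ∀ b : Fin 4 → ℝ, 0 ≤ ∑ i, ∑ j, P i j * (b i * b j)) (C : Matrix (Fin 4) (Fin 4) ℝ) :
    0 ≤ ∑ i, ∑ j, P i j * (Cᵀ * W * C) i j := by
  obtain ⟨B, hB⟩ := CStarAlgebra.nonneg_iff_eq_star_mul_self.mp hW.nonneg
  have h : Cᵀ * W * C = (B * C)ᵀ * (B * C) := by
    rw [hB, Matrix.transpose_mul, Matrix.star_eq_conjTranspose,
      Matrix.conjTranspose_eq_transpose_of_trivial]
    simp only [Matrix.mul_assoc]
  have h2 : ∑ i, ∑ j, P i j * (Cᵀ * W * C) i j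
      = ∑ k, ∑ i, ∑ j, P i j * ((B * C) k i * (B * C) k j) := by
    rw [h]
    generalize B * C = D
    simp only [Matrix.mul_apply, Matrix.transpose_apply, Finset.mul_sum]
    rw [Finset.sum_comm' (t' := Finset.univ) (s' := fun _ => Finset.univ) (by simp)]
    conv_rhs => rw [Finset.sum_comm]
    rw [Finset.sum_comm]
    exact Finset.sum_congr rfl fun i _ => Finset.sum_comm
  rw [h2]
  exact Finset.sum_nonneg fun k _ => hP _

/-- Both `coeffMat` and `adjMulMat` commute with the complex structure, so only the Hermitian part Y
of S contributes. The value follows from the Cayley-Hamilton consequence Y·adj X·Y = tr(adj X·Y)·Y −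
det Y·X. -/
lemma sum_coeffMat_mul_adjMulMat (z : ℝ) (m X Y: Fin 4 → ℝ) (S : Matrix (Fin 4) (Fin 4) ℝ)
     (hY : herm S = Y) (hS : ∀ i j, S i j = S j i) :
    ∑ i, ∑ j, coeffMat z m i j * ((adjMulMat X Y)ᵀ * S) i j
      = z * (hpol X Y * hpol m Y - hdet Y * hpol m X) := by
  have h10 := hS 1 0
  have h32 := hS 3 2
  have h30 := hS 3 0
  have h21 := hS 2 1
  have h20 := hS 2 0
  have h31 := hS 3 1
  have e0 : S 0 0 = Y 0 - S 2 2 := by rw [← hY]; simp [herm]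
  have e1 : S 1 1 = Y 1 - S 3 3 := by rw [← hY]; simp [herm]
  have e2 : S 0 1 = Y 2 - S 2 3 := by rw [← hY]; simp [herm]; linarith
  have e3 : S 0 3 = Y 3 + S 1 2 := by rw [← hY]; simp [herm]; linarith
  simp [Fin.sum_univ_four, coeffMat, adjMulMat, Matrix.mul_apply]
  rw [h10, h32, h30, h21, h20, h31, e0, e1, e2, e3]
  simp only [hpol, hdet]
  ring

/-- The same mechanism with W in the middle: adj X·X·adj X = det X·adj X, so the previous value
reappears multiplied by det X. -/
lemma sum_coeffMat_mul_adjMulMat_conj (z : ℝ) (m X Y: Fin 4 → ℝ) (W : Matrix (Fin 4) (Fin 4) ℝ)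
     (hX : herm W = X) (hW : ∀ i j, W i j = W j i) :
    ∑ i, ∑ j, coeffMat z m i j * ((adjMulMat X Y)ᵀ * W * adjMulMat X Y) i j
      = hdet X * (z * (hpol X Y * hpol m Y - hdet Y * hpol m X)) := by
  have h10 := hW 1 0
  have h32 := hW 3 2
  have h30 := hW 3 0
  have h21 := hW 2 1
  have h20 := hW 2 0
  have h31 := hW 3 1
  have e0 : W 0 0 = X 0 - W 2 2 := by rw [← hX]; simp [herm]
  have e1 : W 1 1 = X 1 - W 3 3 := by rw [← hX]; simp [herm]
  have e2 : W 0 1 = X 2 - W 2 3 := by rw [← hX]; simp [herm]; linarith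
  have e3 : W 0 3 = X 3 + W 1 2 := by rw [← hX]; simp [herm]; linarith
  simp [Fin.sum_univ_four, coeffMat, adjMulMat, Matrix.mul_apply]
  rw [h10, h32, h30, h21, h20, h31, e0, e1, e2, e3]
  simp only [hpol, hdet]
  ring

/-- Write D = zY + yX and m = zX + pp*, and substitute zY = D − yX: the terms in y²·det X cancel.
The coefficient of det D that remains is z²·det X − z·tr(adj m·X), which equals −det m because m −
zX = pp* has rank one and hence determinant zero. -/
lemma hdet_linearization (X Y p : Fin 4 → ℝ) (y z : ℝ) :
    z ^ 2 * (hdet X * hdet (z • Y + y • X) + hdet X * (y * hpol (z • X + outer p p) Y)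
        + z * (hpol X Y * hpol (z • X + outer p p) Y - hdet Y * hpol (z • X + outer p p) X))
      = -(hdet (z • Y + y • X) * hdet (z • X + outer p p))
        + z * hpol (z • X + outer p p) (z • Y + y • X)
          * (hpol (z • Y + y • X) X - y * hdet X) := by
  simp only [hpol, hdet, outer, Pi.add_apply, Pi.smul_apply, smul_eq_mul, Matrix.cons_val]
  ring

lemma hdet_add (m n : Fin 4 → ℝ) : hdet (m + n) = hdet m + hpol m n + hdet n := by
  simp only [hpol, hdet, Pi.add_apply]
  ring

lemma hdet_smul (c : ℝ) (m : Fin 4 → ℝ) : hdet (c • m) = c ^ 2 * hdet m := by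
  simp only [hdet, Pi.smul_apply, smul_eq_mul]
  ring

lemma hpol_add (m n n' : Fin 4 → ℝ) : hpol m (n + n') = hpol m n + hpol m n' := by
  simp only [hpol, Pi.add_apply]
  ring

lemma hpol_smul (c : ℝ) (m n : Fin 4 → ℝ) : hpol m (c • n) = c * hpol m n := by
  simp only [hpol, Pi.smul_apply, smul_eq_mul]
  ring

lemma hpol_outer_eq_sum (m p g : Fin 4 → ℝ) :
    hpol m (outer p g) = ∑ i, hpol m (outer p (Pi.single i 1)) * g i := by
  simp [Fin.sum_univ_four, hpol, outer]
  ring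

/-! ### The pointwise algebraic inequality -/

/-- The coefficient of `s` in the error bound `weighted_hess_le`. -/
def errCoeff (W S : Matrix (Fin 4) (Fin 4) ℝ) (p u : Fin 4 → ℝ) (z y s : ℝ) : ℝ :=
  2 * s * hpol (mform W p z) (outer p u) ^ 2
    + 4 * z * hpol (mform W p z) (outer p u)
      * (hpol (z • herm S + y • herm W) (herm W) - y * hdet (herm W))
    - z ^ 2 * hdet (herm W) * (4 * hpol (z • herm S + y • herm W) (outer p u)
      + 8 * s * hdet (outer p u) + hpol (mform W p z) (herm W)
      + 2 * s * hpol (mform W p z) (outer u u))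

/-- The coefficient of the `j`-th partial derivative in the error bound `weighted_hess_le`. -/
def errGradCoeff (W S : Matrix (Fin 4) (Fin 4) ℝ) (p u : Fin 4 → ℝ) (z : ℝ) (j : Fin 4) : ℝ :=
  4 * z ^ 2 * ∑ i, coeffMat z (mform W p z) i j * ∑ k, adjMulMat (herm W) (herm S) k i * u k
    - 2 * z ^ 2 * hdet (herm W) * hpol (mform W p z) (outer p (Pi.single j 1))

/-- Makes the linearized operator elliptic without assuming a sign of z. For z = 0 the matrix has
rank one, contradicting determinant 1. For z < 0 the equation gives −z·det X > tr(adj X·pp*), and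
X₀·tr(adj X·pp*) ≥ det X·(p₀² + p₂²) by completing squares, so the corner entry is negative. -/
lemma mul_mform_zero_pos {W : Matrix (Fin 4) (Fin 4) ℝ} {p : Fin 4 → ℝ} {z : ℝ}
    (hm : hdet (mform W p z) = 1) (hX : 0 < hdet (herm W)) (hX0 : 0 ≤ herm W 0) :
    0 < z * mform W p z 0 := by
  have hm0 : mform W p z 0 = z * herm W 0 + (p 0 ^ 2 + p 2 ^ 2) := by
    simp [mform, outer]; ring
  set X := herm W with hXdef
  have hX0' : 0 < X 0 := by
    rcases hX0.lt_or_eq with h | h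
    · exact h
    · simp only [hdet, ← h] at hX
      nlinarith [sq_nonneg (X 2), sq_nonneg (X 3)]
  have hexp : hdet (mform W p z) = z ^ 2 * hdet X + z * hpol X (outer p p) := by
    simp only [mform, ← hXdef, hdet, hpol, outer, Pi.add_apply, Pi.smul_apply, smul_eq_mul,
      Matrix.cons_val]
    ring
  rw [hm] at hexp
  have hz : z ≠ 0 := by
    rintro rfl
    norm_num at hexp
  rcases hz.lt_or_gt with hz | hz
  · have h1 : 0 < (-z) * hdet X - hpol X (outer p p) := by nlinarith
    have h2 : X 0 * hpol X (outer p p) = hdet X * (p 0 ^ 2 + p 2 ^ 2)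
        + ((X 0 * p 1 - X 2 * p 0 + X 3 * p 2) ^ 2 + (X 0 * p 3 - X 2 * p 2 - X 3 * p 0) ^ 2) := by
      simp only [hdet, hpol, outer, Matrix.cons_val]
      ring
    have h3 : 0 < hdet X * (-(z * X 0) - (p 0 ^ 2 + p 2 ^ 2)) := by
      nlinarith [mul_pos hX0' h1, sq_nonneg (X 0 * p 1 - X 2 * p 0 + X 3 * p 2),
        sq_nonneg (X 0 * p 3 - X 2 * p 2 - X 3 * p 0)]
    have h4 := pos_of_mul_pos_right h3 hX.le
    rw [hm0]
    nlinarith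
  · rw [hm0]
    positivity

/-- The algebraic core of the constant rank theorem: the second derivatives of a Schur complement
of `W`, contracted with the linearized operator, are controlled by the Schur complement `s`
and its gradient `g`. -/
lemma weighted_hess_le {W S N V : Matrix (Fin 4) (Fin 4) ℝ} {p u g : Fin 4 → ℝ} {z y s : ℝ}
    (hW : W.PosSemidef) (hS : ∀ i j, S i j = S j i) (hm : hdet (mform W p z) = 1)
    (hX : 0 < hdet (herm W))
    (h1 : hpol (mform W p z) (z • herm S + y • herm W + (2 * s) • outer p u) = 0)
    (h2 : 2 * hdet (z • herm S + y • herm W + (2 * s) • outer p u)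
      + hpol (mform W p z) (z • herm V + (2 * y) • herm S + s • herm W + (2 : ℝ) • outer p g
        + (2 * s ^ 2) • outer u u) = 0)
    (hWN : W * N = Matrix.vecMulVec u g - S) :
    z ^ 2 * hdet (herm W) * ∑ i, ∑ j, coeffMat z (mform W p z) i j * (V - 2 • (Nᵀ * W * N)) i j
      ≤ errCoeff W S p u z y s * s + ∑ j, errGradCoeff W S p u z j * g j := by
  have hWs : ∀ i j, W i j = W j i := fun i j => by simpa using (hW.1.apply i j).symm
  have hWt : Wᵀ = W := by ext i j; exact hWs j i
  have hX0 : 0 ≤ herm W 0 := by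
    have := add_nonneg (hW.diag_nonneg (i := 0)) (hW.diag_nonneg (i := 2))
    simpa [herm] using this
  have hzm := mul_mform_zero_pos hm hX hX0
  have hlin := hdet_linearization (herm W) (herm S) p y z
  have hcs := four_mul_hdet_mul_hdet_le (by rw [hm]; exact one_pos : 0 < hdet (mform W p z))
    (z • herm S + y • herm W)
  have hQS := sum_coeffMat_mul_adjMulMat z (mform W p z) (herm W) (herm S) S rfl hS
  have hQW := sum_coeffMat_mul_adjMulMat_conj z (mform W p z) (herm W) (herm S) W rfl hWs
  -- With δ = det X and Q = adj X·Y, the matrix δN + Q measures the deviation of N from −X⁻¹Y.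
  -- Positivity of its W-square bounds NᵀWN from below without inverting W.
  have hpos := sum_mul_conj_nonneg hW (coeffMat_quadratic_nonneg hzm (by rw [hm]; exact zero_le_one))
    (hdet (herm W) • N + adjMulMat (herm W) (herm S))
  have hV := sum_coeffMat_mul z (mform W p z) V
  have hcomm := coeffMat_comm z (mform W p z)
  rw [← mform] at hlin
  unfold errCoeff errGradCoeff
  rw [hpol_add, hpol_smul] at h1
  rw [hdet_add, hdet_smul, hpol_smul] at h2
  simp only [hpol_add _ _ (_ • outer _ _), hpol_add _ _ (_ • herm W), hpol_add _ _ ((2 * y) • _),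
    hpol_smul (2 * y), hpol_smul s, hpol_smul 2, hpol_smul (2 * s ^ 2), hpol_smul z] at h2
  generalize hD : z • herm S + y • herm W = D at *
  generalize hQ : adjMulMat (herm W) (herm S) = Q at *
  generalize hδ : hdet (herm W) = δ at *
  generalize mform W p z = m at *
  have hNW : (W * N)ᵀ = Nᵀ * W := by rw [Matrix.transpose_mul, hWt]
  have hexpand : (δ • N + Q)ᵀ * W * (δ • N + Q) = δ ^ 2 • (Nᵀ * W * N)
      + δ • (Qᵀ * (W * N)) + δ • (Qᵀ * (W * N))ᵀ + Qᵀ * W * Q := by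
    rw [Matrix.transpose_mul, hNW, Matrix.transpose_transpose, Matrix.transpose_add,
      Matrix.transpose_smul]
    simp only [Matrix.add_mul, Matrix.mul_add, Matrix.smul_mul, Matrix.mul_smul, smul_smul,
      Matrix.mul_assoc, smul_add]
    rw [← sq]
    abel
  have hT : ∀ B : Matrix (Fin 4) (Fin 4) ℝ,
      ∑ i, ∑ j, coeffMat z m i j * Bᵀ i j = ∑ i, ∑ j, coeffMat z m i j * B i j := by
    intro B
    rw [Finset.sum_comm]
    simp only [Matrix.transpose_apply]
    exact Finset.sum_congr rfl fun i _ => Finset.sum_congr rfl fun j _ => by rw [hcomm]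
  have hadd : ∀ B C : Matrix (Fin 4) (Fin 4) ℝ, ∑ i, ∑ j, coeffMat z m i j * (B + C) i j
      = ∑ i, ∑ j, coeffMat z m i j * B i j + ∑ i, ∑ j, coeffMat z m i j * C i j := by
    intro B C
    simp only [Matrix.add_apply, mul_add, Finset.sum_add_distrib]
  have hsub : ∀ B C : Matrix (Fin 4) (Fin 4) ℝ, ∑ i, ∑ j, coeffMat z m i j * (B - C) i j
      = ∑ i, ∑ j, coeffMat z m i j * B i j - ∑ i, ∑ j, coeffMat z m i j * C i j := by
    intro B C
    simp only [Matrix.sub_apply, mul_sub, Finset.sum_sub_distrib]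
  have hsmul : ∀ (c : ℝ) (B : Matrix (Fin 4) (Fin 4) ℝ), ∑ i, ∑ j, coeffMat z m i j * (c • B) i j
      = c * ∑ i, ∑ j, coeffMat z m i j * B i j := by
    intro c B
    simp only [Matrix.smul_apply, smul_eq_mul, Finset.mul_sum]
    exact Finset.sum_congr rfl fun i _ => Finset.sum_congr rfl fun j _ => by ring
  have hug : ∑ i, ∑ j, coeffMat z m i j * (Qᵀ * Matrix.vecMulVec u g) i j
      = ∑ j, (∑ i, coeffMat z m i j * ∑ k, Q k i * u k) * g j := by
    rw [Finset.sum_comm]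
    simp only [Matrix.mul_apply, Matrix.transpose_apply, Matrix.vecMulVec_apply, Finset.sum_mul,
      Finset.mul_sum]
    exact Finset.sum_congr rfl fun i _ => Finset.sum_congr rfl fun j _ =>
      Finset.sum_congr rfl fun k _ => by ring
  have hg : ∑ j, (4 * z ^ 2 * ∑ i, coeffMat z m i j * ∑ k, Q k i * u k
        - 2 * z ^ 2 * δ * hpol m (outer p (Pi.single j 1))) * g j
      = 4 * z ^ 2 * ∑ i, ∑ j, coeffMat z m i j * (Qᵀ * Matrix.vecMulVec u g) i j
        - 2 * z ^ 2 * δ * hpol m (outer p g) := by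
    rw [hug, hpol_outer_eq_sum, Finset.mul_sum, Finset.mul_sum, ← Finset.sum_sub_distrib]
    exact Finset.sum_congr rfl fun j _ => by ring
  have h2s : (2 : ℕ) • (Nᵀ * W * N) = (2 : ℝ) • (Nᵀ * W * N) := by
    rw [ofNat_smul_eq_nsmul ℝ 2]
  rw [hg, h2s, hsub, hsmul, hV]
  rw [hexpand, hadd, hadd, hadd, hsmul, hsmul, hsmul, hT, hWN, Matrix.mul_sub, hsub, hQS, hQW]
    at hpos
  generalize ∑ i, ∑ j, coeffMat z m i j * (Nᵀ * W * N) i j = ν at *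
  generalize ∑ i, ∑ j, coeffMat z m i j * (Qᵀ * Matrix.vecMulVec u g) i j = q at *
  set τ := z * (hpol (herm W) (herm S) * hpol m (herm S) - hdet (herm S) * hpol m (herm W)) with hτ
  -- In the expanded square, the cross terms give 2δ(q − τ) and the last term gives δτ; one factor δ
  -- > 0 cancels.
  have hν : 0 ≤ δ * ν + 2 * q - τ := by
    refine nonneg_of_mul_nonneg_right (b := δ * ν + 2 * q - τ) (a := δ) ?_ hX
    linarith
  -- The once differentiated equation: D is orthogonal to m up to a multiple of s. Hence `hcs`
  -- bounds det D by a multiple of s².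
  have hl : hpol m D = -(2 * s * hpol m (outer p u)) := by linarith
  rw [hl, hm] at hlin hcs
  have hz2 := sq_nonneg z
  have h3 := mul_nonneg hz2 hν
  -- The twice differentiated equation eliminates V. Combined with `h3` and `hlin`, what remains is
  -- 2·det D plus terms carrying s or g.
  have h4 : z * hpol m (herm V) = -(2 * (hdet D + 2 * s * hpol D (outer p u)
    + (2 * s) ^ 2 * hdet (outer p u)) + (2 * y * hpol m (herm S) + s * hpol m (herm W)
    + 2 * hpol m (outer p g) + 2 * s ^ 2 * hpol m (outer u u))) := by linarith
  rw [h4]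
  nlinarith

/-! ### Directional derivatives and convexity -/

/-- The domain space `ℝ⁴`. -/
abbrev E4 := EuclideanSpace ℝ (Fin 4)

/-- The directional derivative of `f` along the constant vector field `ξ`. -/
def dirD (ξ : E4) (f : E4 → ℝ) (x : E4) : ℝ := fderiv ℝ f x ξ

lemma partialD_eq_dirD (i : Fin 4) (f : E4 → ℝ) (x : E4) :
    partialD i f x = dirD (EuclideanSpace.single i 1) f x := rfl

lemma dirD_eq_sum (ξ : E4) (f : E4 → ℝ) (x : E4) :
    dirD ξ f x = ∑ k, ξ k * partialD k f x := by
  have h : ξ = ∑ k, ξ k • EuclideanSpace.single k (1 : ℝ) := by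
    ext i
    simp [Finset.sum_apply, Pi.single_apply]
  conv_lhs => rw [dirD, h, map_sum]
  simp [partialD]

lemma dirD_add {ξ : E4} {f g : E4 → ℝ} {x : E4} (hf : DifferentiableAt ℝ f x)
    (hg : DifferentiableAt ℝ g x) : dirD ξ (fun y => f y + g y) x = dirD ξ f x + dirD ξ g x := by
  simp [dirD, fderiv_fun_add hf hg]

lemma dirD_sub {ξ : E4} {f g : E4 → ℝ} {x : E4} (hf : DifferentiableAt ℝ f x)
    (hg : DifferentiableAt ℝ g x) : dirD ξ (fun y => f y - g y) x = dirD ξ f x - dirD ξ g x := by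
  simp [dirD, fderiv_fun_sub hf hg]

lemma dirD_mul {ξ : E4} {f g : E4 → ℝ} {x : E4} (hf : DifferentiableAt ℝ f x)
    (hg : DifferentiableAt ℝ g x) :
    dirD ξ (fun y => f y * g y) x = dirD ξ f x * g x + f x * dirD ξ g x := by
  simp [dirD, fderiv_fun_mul hf hg]
  ring

lemma dirD_const_mul {ξ : E4} {f : E4 → ℝ} {x : E4} (c : ℝ) (hf : DifferentiableAt ℝ f x) :
    dirD ξ (fun y => c * f y) x = c * dirD ξ f x := by
  simp [dirD, fderiv_const_mul hf]

lemma dirD_const {ξ : E4} {x : E4} (c : ℝ) : dirD ξ (fun _ => c) x = 0 := by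
  simp [dirD]

lemma dirD_sum {ι : Type*} {t : Finset ι} {ξ : E4} {f : ι → E4 → ℝ} {x : E4}
    (hf : ∀ i ∈ t, DifferentiableAt ℝ (f i) x) :
    dirD ξ (fun y => ∑ i ∈ t, f i y) x = ∑ i ∈ t, dirD ξ (f i) x := by
  simp [dirD, fderiv_fun_sum hf]

lemma dirD_congr {Ω : Set E4} (hΩ : IsOpen Ω) {ξ : E4} {f g : E4 → ℝ} (h : ∀ y ∈ Ω, f y = g y)
    {x : E4} (hx : x ∈ Ω) : dirD ξ f x = dirD ξ g x := by
  have : f =ᶠ[nhds x] g := Filter.eventuallyEq_of_mem (hΩ.mem_nhds hx) h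
  rw [dirD, dirD, this.fderiv_eq]

lemma contDiffOn_dirD {Ω : Set E4} (hΩ : IsOpen Ω) {ξ : E4} {f : E4 → ℝ} {m n : WithTop ℕ∞}
    (hf : ContDiffOn ℝ n f Ω) (hmn : m + 1 ≤ n) : ContDiffOn ℝ m (dirD ξ f) Ω :=
  (hf.fderiv_of_isOpen hΩ hmn).clm_apply contDiffOn_const

lemma contDiffOn_partialD {Ω : Set E4} (hΩ : IsOpen Ω) (i : Fin 4) {f : E4 → ℝ}
    {m n : WithTop ℕ∞} (hf : ContDiffOn ℝ n f Ω) (hmn : m + 1 ≤ n) :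
    ContDiffOn ℝ m (partialD i f) Ω :=
  contDiffOn_dirD hΩ hf hmn

lemma dirD_comm {Ω : Set E4} (hΩ : IsOpen Ω) {ξ η : E4} {f : E4 → ℝ} (hf : ContDiffOn ℝ 2 f Ω)
    {x : E4} (hx : x ∈ Ω) : dirD ξ (dirD η f) x = dirD η (dirD ξ f) x := by
  have hd : DifferentiableAt ℝ (fderiv ℝ f) x :=
    ((hf.fderiv_of_isOpen hΩ (m := 1) (by norm_num)).differentiableOn (by norm_num)).differentiableAt
      (hΩ.mem_nhds hx)
  have h : ∀ ξ η : E4, dirD ξ (dirD η f) x = fderiv ℝ (fderiv ℝ f) x ξ η := by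
    intro ξ η
    change fderiv ℝ (fun y => fderiv ℝ f y η) x ξ = _
    rw [fderiv_clm_apply hd (differentiableAt_const _)]
    simp
  rw [h, h]
  exact (hf.contDiffAt (hΩ.mem_nhds hx)).isSymmSndFDerivAt (by simp) ξ η

lemma partialD_comm {Ω : Set E4} (hΩ : IsOpen Ω) (i j : Fin 4) {f : E4 → ℝ}
    (hf : ContDiffOn ℝ 2 f Ω) {x : E4} (hx : x ∈ Ω) :
    partialD i (partialD j f) x = partialD j (partialD i f) x :=
  dirD_comm hΩ hf hx

lemma differentiableAt_of_contDiffOn {Ω : Set E4} (hΩ : IsOpen Ω) {f : E4 → ℝ}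
    {n : WithTop ℕ∞} (hf : ContDiffOn ℝ n f Ω) (hn : n ≠ 0) {x : E4} (hx : x ∈ Ω) :
    DifferentiableAt ℝ f x :=
  (hf.differentiableOn hn).differentiableAt (hΩ.mem_nhds hx)

lemma hasDerivAt_line {f : E4 → ℝ} {x ξ : E4} {t : ℝ} (hf : DifferentiableAt ℝ f (x + t • ξ)) :
    HasDerivAt (fun t : ℝ => f (x + t • ξ)) (dirD ξ f (x + t • ξ)) t := by
  have h1 : HasDerivAt (fun t : ℝ => x + t • ξ) ξ t := by
    simpa using ((hasDerivAt_id t).smul_const ξ).const_add x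
  exact hf.hasFDerivAt.comp_hasDerivAt t h1

/-- Ω need not be convex, so v is restricted to the part of a line inside a ball around x; there its
derivative is monotone. -/
lemma dirD_dirD_nonneg {Ω : Set E4} (hΩ : IsOpen Ω) {v : E4 → ℝ} (hv : ContDiffOn ℝ 2 v Ω)
    (hconv : IsConvexFunction Ω v) {x : E4} (hx : x ∈ Ω) (ξ : E4) :
    0 ≤ dirD ξ (dirD ξ v) x := by
  obtain ⟨r, hr, hball⟩ := Metric.isOpen_iff.mp hΩ x hx
  let L : ℝ →ᵃ[ℝ] E4 := AffineMap.lineMap x (x + ξ)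
  have hL : ∀ t : ℝ, L t = x + t • ξ := by
    intro t
    simp [L, AffineMap.lineMap_apply, add_comm]
  have hcont : Continuous fun t : ℝ => x + t • ξ := by fun_prop
  let I : Set ℝ := L ⁻¹' Metric.ball x r
  have hI : I = (fun t : ℝ => x + t • ξ) ⁻¹' Metric.ball x r := by
    ext t
    simp only [I, Set.mem_preimage, hL]
  have hIo : IsOpen I := hI ▸ Metric.isOpen_ball.preimage hcont
  have h0 : (0 : ℝ) ∈ I := by
    rw [hI]
    simpa using hr
  have hmem : ∀ t ∈ I, x + t • ξ ∈ Ω := fun t ht => hball (by rw [hI] at ht; exact ht)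
  have hg : ConvexOn ℝ I (fun t : ℝ => v (x + t • ξ)) := by
    have := (hconv _ hball (convex_ball x r)).comp_affineMap L
    refine this.congr fun t _ => ?_
    simp [hL]
  have hd : ∀ t ∈ I, HasDerivAt (fun t : ℝ => v (x + t • ξ)) (dirD ξ v (x + t • ξ)) t :=
    fun t ht => hasDerivAt_line (differentiableAt_of_contDiffOn hΩ hv (by norm_num) (hmem t ht))
  have hmono : MonotoneOn (fun t : ℝ => dirD ξ v (x + t • ξ)) I := by
    refine (hg.monotoneOn_deriv fun t ht => (hd t ht).differentiableAt).congr fun t ht => ?_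
    exact (hd t ht).deriv
  have h2 := hmono.derivWithin_nonneg (x := 0)
  rw [derivWithin_of_isOpen hIo h0] at h2
  have h3 : HasDerivAt (fun t : ℝ => dirD ξ v (x + t • ξ)) (dirD ξ (dirD ξ v) (x + (0 : ℝ) • ξ))
      0 := hasDerivAt_line (differentiableAt_of_contDiffOn hΩ
        (contDiffOn_dirD hΩ hv (m := 1) (by norm_num)) (by norm_num) (hmem 0 h0))
  rw [h3.deriv] at h2
  simpa using h2

lemma hess_symm {Ω : Set E4} (hΩ : IsOpen Ω) {v : E4 → ℝ} (hv : ContDiffOn ℝ 2 v Ω)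
    {x : E4} (hx : x ∈ Ω) (i j : Fin 4) : hess v x i j = hess v x j i :=
  partialD_comm hΩ j i hv hx

lemma dirD_dirD_eq_sum {Ω : Set E4} (hΩ : IsOpen Ω) {f : E4 → ℝ} (hf : ContDiffOn ℝ 2 f Ω)
    {x : E4} (hx : x ∈ Ω) (ξ : E4) :
    dirD ξ (dirD ξ f) x = ∑ i, ∑ j, ξ i * ξ j * partialD j (partialD i f) x := by
  have h : ∀ y ∈ Ω, dirD ξ f y = ∑ i, ξ i * partialD i f y := fun y _ => dirD_eq_sum ξ f y
  have hd : ∀ i, DifferentiableAt ℝ (partialD i f) x := fun i =>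
    differentiableAt_of_contDiffOn hΩ (contDiffOn_partialD hΩ i hf (m := 1) (by norm_num))
      (by norm_num) hx
  rw [dirD_congr hΩ h hx, dirD_sum fun i _ => (hd i).const_mul _]
  refine Finset.sum_congr rfl fun i _ => ?_
  rw [dirD_const_mul _ (hd i), dirD_eq_sum, Finset.mul_sum]
  exact Finset.sum_congr rfl fun j _ => by ring

lemma hess_posSemidef {Ω : Set E4} (hΩ : IsOpen Ω) {v : E4 → ℝ} (hv : ContDiffOn ℝ 2 v Ω)
    (hconv : IsConvexFunction Ω v) {x : E4} (hx : x ∈ Ω) : (hess v x).PosSemidef := by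
  refine Matrix.PosSemidef.of_dotProduct_mulVec_nonneg ?_ fun ξ => ?_
  · ext i j
    simpa using hess_symm hΩ hv hx j i
  · have h := dirD_dirD_nonneg hΩ hv hconv hx (WithLp.toLp 2 ξ)
    rw [dirD_dirD_eq_sum hΩ hv hx] at h
    refine h.trans_eq ?_
    simp only [dotProduct, Matrix.mulVec, Pi.star_apply, star_trivial, Finset.mul_sum]
    exact Finset.sum_congr rfl fun i _ => Finset.sum_congr rfl fun j _ => by
      simp only [hess, Matrix.of_apply]; ring

/-! ### Derivatives of a Schur complement -/

/-- First and second derivatives of a Schur complement `s` of a field `W` of symmetric matrices,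
where `W ξ = s • u` and the coordinate `ξ m` is constant. -/
lemma partialD_schur {O : Set E4} (hO : IsOpen O) {W : Fin 4 → Fin 4 → E4 → ℝ}
    {ξ : Fin 4 → E4 → ℝ} {s : E4 → ℝ} (m : Fin 4)
    (hW : ∀ a b, ContDiffOn ℝ 2 (W a b) O) (hξ : ∀ a, ContDiffOn ℝ 2 (ξ a) O)
    (hs : ContDiffOn ℝ 2 s O) (hsymm : ∀ a b, ∀ y ∈ O, W a b y = W b a y)
    (hWξ : ∀ a, ∀ y ∈ O, ∑ b, W a b y * ξ b y = s y * (Pi.single m 1 : Fin 4 → ℝ) a)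
    (hξm : ∀ y ∈ O, ξ m y = 1) :
    (∀ i a, ∀ y ∈ O, ∑ b, W a b y * partialD i (ξ b) y
      = (Pi.single m 1 : Fin 4 → ℝ) a * partialD i s y - ∑ b, partialD i (W a b) y * ξ b y) ∧
    (∀ i, ∀ y ∈ O, partialD i s y = ∑ a, ∑ b, ξ a y * ξ b y * partialD i (W a b) y) ∧
    (∀ i j, ∀ y ∈ O, partialD j (partialD i s) y
      = ∑ a, ∑ b, ξ a y * ξ b y * partialD j (partialD i (W a b)) y
        - 2 * ∑ a, ∑ b, partialD i (ξ a) y * W a b y * partialD j (ξ b) y) := by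
  have dW : ∀ a b, ∀ y ∈ O, DifferentiableAt ℝ (W a b) y := fun a b y hy =>
    differentiableAt_of_contDiffOn hO (hW a b) (by norm_num) hy
  have dξ : ∀ a, ∀ y ∈ O, DifferentiableAt ℝ (ξ a) y := fun a y hy =>
    differentiableAt_of_contDiffOn hO (hξ a) (by norm_num) hy
  have ds : ∀ y ∈ O, DifferentiableAt ℝ s y := fun y hy =>
    differentiableAt_of_contDiffOn hO hs (by norm_num) hy
  have dW' : ∀ i a b, ∀ y ∈ O, DifferentiableAt ℝ (partialD i (W a b)) y := fun i a b y hy =>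
    differentiableAt_of_contDiffOn hO (contDiffOn_partialD hO i (hW a b) (m := 1) (by norm_num))
      (by norm_num) hy
  have dξm : ∀ i, ∀ y ∈ O, partialD i (ξ m) y = 0 := fun i y hy => by
    rw [partialD_eq_dirD, dirD_congr hO hξm hy, dirD_const]
  have dWs : ∀ i a b, ∀ y ∈ O, partialD i (W a b) y = partialD i (W b a) y := fun i a b y hy =>
    dirD_congr hO (hsymm a b) hy
  have h1 : ∀ i a, ∀ y ∈ O, ∑ b, W a b y * partialD i (ξ b) y
      = (Pi.single m 1 : Fin 4 → ℝ) a * partialD i s y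
        - ∑ b, partialD i (W a b) y * ξ b y := by
    intro i a y hy
    have h := dirD_congr hO (ξ := EuclideanSpace.single i 1) (hWξ a) hy
    rw [dirD_sum fun b _ => (dW a b y hy).fun_mul (dξ b y hy), dirD_mul (ds y hy)
      (differentiableAt_const _), dirD_const] at h
    simp only [dirD_mul (dW a _ y hy) (dξ _ y hy), Finset.sum_add_distrib,
      ← partialD_eq_dirD] at h
    linarith
  have hsm : ∀ c : Fin 4 → ℝ, ∑ a, (Pi.single m 1 : Fin 4 → ℝ) a * c a = c m := by
    intro c
    simp [Pi.single_apply]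
  have h2 : ∀ i, ∀ y ∈ O,
      partialD i s y = ∑ a, ∑ b, ξ a y * ξ b y * partialD i (W a b) y := by
    intro i y hy
    -- By symmetry of W this is (Wξ)·∂_iξ = s·∂_iξ_m, which vanishes because ξ_m is constant.
    have e1 : ∑ a, ξ a y * ∑ b, W a b y * partialD i (ξ b) y = 0 := by
      have : ∑ a, ξ a y * ∑ b, W a b y * partialD i (ξ b) y
          = ∑ b, (∑ a, W b a y * ξ a y) * partialD i (ξ b) y := by
        simp only [Finset.mul_sum, Finset.sum_mul]
        rw [Finset.sum_comm]
        exact Finset.sum_congr rfl fun b _ => Finset.sum_congr rfl fun a _ => by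
          rw [hsymm a b y hy]; ring
      rw [this]
      simp only [hWξ _ y hy]
      have := hsm fun b => s y * partialD i (ξ b) y
      rw [dξm i y hy, mul_zero] at this
      rw [← this]
      exact Finset.sum_congr rfl fun b _ => by ring
    simp only [h1 i _ y hy, mul_sub, Finset.sum_sub_distrib] at e1
    have e2 := hsm fun a => ξ a y * partialD i s y
    rw [hξm y hy, one_mul] at e2
    have e3 : ∑ a, ξ a y * ((Pi.single m 1 : Fin 4 → ℝ) a * partialD i s y) = partialD i s y := by
      rw [← e2]
      exact Finset.sum_congr rfl fun b _ => by rw [e2]; ring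
    rw [e3, sub_eq_zero] at e1
    rw [e1]
    simp only [Finset.mul_sum]
    exact Finset.sum_congr rfl fun b _ => Finset.sum_congr rfl fun a _ => by ring
  refine ⟨h1, h2, ?_⟩
  intro i j y hy
  have e0 : partialD j (partialD i s) y = ∑ a, ∑ b,
      ((partialD j (ξ a) y * ξ b y + ξ a y * partialD j (ξ b) y) * partialD i (W a b) y
        + ξ a y * ξ b y * partialD j (partialD i (W a b)) y) := by
    rw [partialD_eq_dirD, dirD_congr hO (h2 i) hy, dirD_sum fun a _ =>
      DifferentiableAt.fun_sum fun b _ => ((dξ a y hy).fun_mul (dξ b y hy)).fun_mul (dW' i a b y hy)]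
    refine Finset.sum_congr rfl fun a _ => ?_
    rw [dirD_sum fun b _ => ((dξ a y hy).fun_mul (dξ b y hy)).fun_mul (dW' i a b y hy)]
    refine Finset.sum_congr rfl fun b _ => ?_
    rw [dirD_mul ((dξ a y hy).fun_mul (dξ b y hy)) (dW' i a b y hy),
      dirD_mul (dξ a y hy) (dξ b y hy)]
    rfl
  -- Pair the differentiated relation with ∂_jξ: the term containing ∂_i s drops out since ∂_jξ_m =
  -- 0. The two cross terms of `e0` thus become one W-quadratic term with factor −2.
  have e1 : ∑ a, ∑ b, partialD i (ξ a) y * W a b y * partialD j (ξ b) y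
      = - ∑ a, ∑ b, partialD j (ξ a) y * ξ b y * partialD i (W a b) y := by
    have : ∑ a, ∑ b, partialD i (ξ a) y * W a b y * partialD j (ξ b) y
        = ∑ b, partialD j (ξ b) y * ∑ a, W b a y * partialD i (ξ a) y := by
      simp only [Finset.mul_sum]
      rw [Finset.sum_comm]
      exact Finset.sum_congr rfl fun b _ => Finset.sum_congr rfl fun a _ => by
        rw [hsymm a b y hy]; ring
    rw [this]
    simp only [h1 i _ y hy, mul_sub, Finset.sum_sub_distrib]
    have e2 := hsm fun a => partialD j (ξ a) y * partialD i s y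
    rw [dξm j y hy, zero_mul] at e2
    have e3 : ∑ a, partialD j (ξ a) y * ((Pi.single m 1 : Fin 4 → ℝ) a * partialD i s y) = 0 := by
      rw [← e2]
      exact Finset.sum_congr rfl fun b _ => by ring
    rw [e3, zero_sub]
    simp only [Finset.mul_sum]
    congr 1
    exact Finset.sum_congr rfl fun b _ => Finset.sum_congr rfl fun a _ => by ring
  have e2 : ∑ a, ∑ b, ξ a y * partialD j (ξ b) y * partialD i (W a b) y
      = ∑ a, ∑ b, partialD j (ξ a) y * ξ b y * partialD i (W a b) y := by
    rw [Finset.sum_comm]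
    exact Finset.sum_congr rfl fun b _ => Finset.sum_congr rfl fun a _ => by
      rw [dWs i a b y hy]; ring
  rw [e0, e1]
  simp only [add_mul, Finset.sum_add_distrib, e2]
  ring

/-! ### Differentiating the equation twice -/

lemma dirD_hdet_eq_zero {Ω : Set E4} (hΩ : IsOpen Ω) (ξ : E4) {μ : E4 → Fin 4 → ℝ}
    (hμ : ∀ k, ContDiffOn ℝ 2 (fun y => μ y k) Ω) (h : ∀ y ∈ Ω, hdet (μ y) = 1) :
    ∀ x ∈ Ω, hpol (μ x) (fun k => dirD ξ (fun y => μ y k) x) = 0 ∧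
      2 * hdet (fun k => dirD ξ (fun y => μ y k) x)
        + hpol (μ x) (fun k => dirD ξ (dirD ξ fun y => μ y k) x) = 0 := by
  have d : ∀ k, ∀ x ∈ Ω, DifferentiableAt ℝ (fun y => μ y k) x := fun k x hx =>
    differentiableAt_of_contDiffOn hΩ (hμ k) (by norm_num) hx
  have d' : ∀ k, ∀ x ∈ Ω, DifferentiableAt ℝ (dirD ξ fun y => μ y k) x := fun k x hx =>
    differentiableAt_of_contDiffOn hΩ (contDiffOn_dirD hΩ (hμ k) (m := 1) (by norm_num))
      (by norm_num) hx
  have h1 : ∀ x ∈ Ω, hpol (μ x) (fun k => dirD ξ (fun y => μ y k) x) = 0 := by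
    intro x hx
    have e := dirD_congr hΩ (ξ := ξ) h hx
    have d0 := d 0 x hx
    have d1 := d 1 x hx
    have d2 := d 2 x hx
    have d3 := d 3 x hx
    simp only [hdet, sq] at e
    rw [dirD_const, dirD_sub (by fun_prop) (by fun_prop), dirD_sub (by fun_prop) (by fun_prop),
      dirD_mul d0 d1, dirD_mul d2 d2, dirD_mul d3 d3] at e
    simp only [hpol]
    linarith
  refine fun x hx => ⟨h1 x hx, ?_⟩
  have e := dirD_congr hΩ (ξ := ξ) h1 hx
  have d0 := d 0 x hx
  have d1 := d 1 x hx
  have d2 := d 2 x hx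
  have d3 := d 3 x hx
  have d0' := d' 0 x hx
  have d1' := d' 1 x hx
  have d2' := d' 2 x hx
  have d3' := d' 3 x hx
  simp only [hpol] at e
  change dirD ξ (fun x => μ x 1 * (dirD ξ fun y => μ y 0) x + μ x 0 * (dirD ξ fun y => μ y 1) x
    - 2 * (μ x 2 * (dirD ξ fun y => μ y 2) x) - 2 * (μ x 3 * (dirD ξ fun y => μ y 3) x)) x = _ at e
  rw [dirD_const, dirD_sub (by fun_prop) (by fun_prop), dirD_sub (by fun_prop) (by fun_prop),
    dirD_add (by fun_prop) (by fun_prop), dirD_const_mul _ (by fun_prop),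
    dirD_const_mul _ (by fun_prop),
    dirD_mul d1 d0', dirD_mul d0 d1', dirD_mul d2 d2', dirD_mul d3 d3'] at e
  simp only [hpol, hdet]
  linarith

lemma dirD_div_const {ξ : E4} {f : E4 → ℝ} {x : E4} (c : ℝ) (hf : DifferentiableAt ℝ f x) :
    dirD ξ (fun y => f y / c) x = dirD ξ f x / c := by
  simp only [div_eq_inv_mul]
  exact dirD_const_mul _ hf

lemma outer_comm (p q : Fin 4 → ℝ) : outer p q = outer q p := by
  ext k
  fin_cases k <;> simp [outer] <;> ring

lemma dirD_herm {ξ : E4} {A : E4 → Matrix (Fin 4) (Fin 4) ℝ} {x : E4}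
    (hA : ∀ i j, DifferentiableAt ℝ (fun y => A y i j) x) (k : Fin 4) :
    dirD ξ (fun y => herm (A y) k) x
      = herm (Matrix.of fun i j => dirD ξ (fun y => A y i j) x) k := by
  fin_cases k <;>
    simp (disch := fun_prop) [herm, dirD_add, dirD_sub, dirD_div_const]

lemma dirD_outer {ξ : E4} {p q : E4 → Fin 4 → ℝ} {x : E4}
    (hp : ∀ i, DifferentiableAt ℝ (fun y => p y i) x)
    (hq : ∀ i, DifferentiableAt ℝ (fun y => q y i) x) (k : Fin 4) :
    dirD ξ (fun y => outer (p y) (q y) k) x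
      = outer (fun i => dirD ξ (fun y => p y i) x) (q x) k
        + outer (p x) (fun i => dirD ξ (fun y => q y i) x) k := by
  fin_cases k <;>
    simp (disch := fun_prop) [outer, dirD_add, dirD_sub, dirD_mul, dirD_div_const] <;> ring

lemma differentiableAt_herm {A : E4 → Matrix (Fin 4) (Fin 4) ℝ} {x : E4}
    (hA : ∀ i j, DifferentiableAt ℝ (fun y => A y i j) x) (k : Fin 4) :
    DifferentiableAt ℝ (fun y => herm (A y) k) x := by
  fin_cases k <;> simp [herm] <;> fun_prop

lemma differentiableAt_outer {p q : E4 → Fin 4 → ℝ} {x : E4}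
    (hp : ∀ i, DifferentiableAt ℝ (fun y => p y i) x)
    (hq : ∀ i, DifferentiableAt ℝ (fun y => q y i) x) (k : Fin 4) :
    DifferentiableAt ℝ (fun y => outer (p y) (q y) k) x := by
  fin_cases k <;> simp [outer] <;> fun_prop

lemma contDiffOn_mform {Ω : Set E4} {n : WithTop ℕ∞} {A : E4 → Matrix (Fin 4) (Fin 4) ℝ}
    {p : E4 → Fin 4 → ℝ} {z : E4 → ℝ} (hA : ∀ i j, ContDiffOn ℝ n (fun y => A y i j) Ω)
    (hp : ∀ i, ContDiffOn ℝ n (fun y => p y i) Ω) (hz : ContDiffOn ℝ n z Ω) (k : Fin 4) :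
    ContDiffOn ℝ n (fun y => mform (A y) (p y) (z y) k) Ω := by
  fin_cases k <;> simp [mform, herm, outer] <;> fun_prop

lemma dirD_mform {Ω : Set E4} (hΩ : IsOpen Ω) (ξ : E4) {A : E4 → Matrix (Fin 4) (Fin 4) ℝ}
    {p : E4 → Fin 4 → ℝ} {z : E4 → ℝ} (hA : ∀ i j, ContDiffOn ℝ 2 (fun y => A y i j) Ω)
    (hp : ∀ i, ContDiffOn ℝ 2 (fun y => p y i) Ω) (hz : ContDiffOn ℝ 2 z Ω) {x : E4}
    (hx : x ∈ Ω) :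
    (fun k => dirD ξ (fun y => mform (A y) (p y) (z y) k) x)
        = z x • herm (Matrix.of fun i j => dirD ξ (fun y => A y i j) x)
          + dirD ξ z x • herm (A x)
          + (2 : ℝ) • outer (p x) (fun i => dirD ξ (fun y => p y i) x) ∧
      (fun k => dirD ξ (dirD ξ fun y => mform (A y) (p y) (z y) k) x)
        = z x • herm (Matrix.of fun i j => dirD ξ (dirD ξ fun y => A y i j) x)
          + (2 * dirD ξ z x) • herm (Matrix.of fun i j => dirD ξ (fun y => A y i j) x)
          + dirD ξ (dirD ξ z) x • herm (A x)
          + (2 : ℝ) • outer (p x) (fun i => dirD ξ (dirD ξ fun y => p y i) x)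
          + (2 : ℝ) • outer (fun i => dirD ξ (fun y => p y i) x)
            (fun i => dirD ξ (fun y => p y i) x) := by
  have d1 : ∀ {f : E4 → ℝ}, ContDiffOn ℝ 2 f Ω → ∀ y ∈ Ω, DifferentiableAt ℝ f y :=
    fun hf y hy => differentiableAt_of_contDiffOn hΩ hf (by norm_num) hy
  have d2 : ∀ {f : E4 → ℝ}, ContDiffOn ℝ 2 f Ω → ∀ y ∈ Ω, DifferentiableAt ℝ (dirD ξ f) y :=
    fun hf y hy => differentiableAt_of_contDiffOn hΩ
      (contDiffOn_dirD hΩ hf (m := 1) (by norm_num)) (by norm_num) hy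
  have h1 : ∀ k, ∀ y ∈ Ω, dirD ξ (fun y => mform (A y) (p y) (z y) k) y
      = z y * herm (Matrix.of fun i j => dirD ξ (fun y => A y i j) y) k
          + dirD ξ z y * herm (A y) k
          + 2 * outer (p y) (fun i => dirD ξ (fun y => p y i) y) k := by
    intro k y hy
    have dh := differentiableAt_herm (fun i j => d1 (hA i j) y hy) k
    have dp := fun i => d1 (hp i) y hy
    have dz := d1 hz y hy
    simp only [mform, Pi.add_apply, Pi.smul_apply, smul_eq_mul]
    rw [dirD_add (dz.fun_mul dh) (differentiableAt_outer dp dp k), dirD_mul dz dh,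
      dirD_herm (fun i j => d1 (hA i j) y hy), dirD_outer dp dp, outer_comm _ (p y)]
    ring
  refine ⟨funext fun k => ?_, funext fun k => ?_⟩
  · simpa using h1 k x hx
  · have dh := differentiableAt_herm (fun i j => d1 (hA i j) x hx) k
    have dh' := differentiableAt_herm
      (A := fun y => Matrix.of fun i j => dirD ξ (fun y => A y i j) y)
      (fun i j => d2 (hA i j) x hx) k
    have dp := fun i => d1 (hp i) x hx
    have dp' := fun i => d2 (hp i) x hx
    have dz := d1 hz x hx
    have dz' := d2 hz x hx
    have do' := differentiableAt_outer (q := fun y i => dirD ξ (fun y => p y i) y) dp dp' k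
    rw [dirD_congr hΩ (h1 k) hx, dirD_add ((dz.fun_mul dh').fun_add (dz'.fun_mul dh))
      (do'.const_mul 2), dirD_add (dz.fun_mul dh') (dz'.fun_mul dh), dirD_mul dz dh',
      dirD_mul dz' dh, dirD_const_mul _ do', dirD_herm (fun i j => d1 (hA i j) x hx),
      dirD_herm (A := fun y => Matrix.of fun i j => dirD ξ (fun y => A y i j) y)
        (fun i j => d2 (hA i j) x hx), dirD_outer (q := fun y i => dirD ξ (fun y => p y i) y) dp dp']
    simp only [Pi.add_apply, Pi.smul_apply, smul_eq_mul, Matrix.of_apply]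
    ring

/-! ### The differential inequality for the Schur complement -/

/-- The differential inequality for a Schur complement `s` of the Hessian of a solution. -/
lemma weighted_hess_schur_le {Ω : Set E4} (hΩ : IsOpen Ω) {v : E4 → ℝ}
    (hv : ContDiffOn ℝ 4 v Ω) (hconv : IsConvexFunction Ω v) (hsol : IsSolution Ω v)
    {O : Set E4} (hO : IsOpen O) (hOΩ : O ⊆ Ω) {ξ : Fin 4 → E4 → ℝ} {s : E4 → ℝ} (m : Fin 4)
    (hξ : ∀ a, ContDiffOn ℝ 2 (ξ a) O) (hs : ContDiffOn ℝ 2 s O)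
    (hWξ : ∀ a, ∀ y ∈ O, ∑ b, hess v y a b * ξ b y = s y * (Pi.single m 1 : Fin 4 → ℝ) a)
    (hξm : ∀ y ∈ O, ξ m y = 1) {x : E4} (hx : x ∈ O) (hX : 0 < hdet (herm (hess v x))) :
    v x ^ 2 * hdet (herm (hess v x)) * ∑ i, ∑ j, coeff v i j x * hess s x i j
      ≤ errCoeff (hess v x)
            (Matrix.of fun a b => ∑ c, ξ c x * partialD c (fun y => hess v y a b) x)
            (grad v x) (Pi.single m 1) (v x) (∑ c, ξ c x * partialD c v x) (s x) * s x
        + ∑ j, errGradCoeff (hess v x)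
            (Matrix.of fun a b => ∑ c, ξ c x * partialD c (fun y => hess v y a b) x)
            (grad v x) (Pi.single m 1) (v x) j * partialD j s x := by
  have hxΩ := hOΩ hx
  have hp3 : ∀ k, ContDiffOn ℝ 3 (partialD k v) Ω := fun k =>
    contDiffOn_partialD hΩ k hv (by norm_num)
  have hW2 : ∀ a b, ContDiffOn ℝ 2 (fun y => hess v y a b) Ω := fun a b =>
    contDiffOn_partialD hΩ b (hp3 a) (by norm_num)
  have hsymm : ∀ y ∈ Ω, ∀ a b, hess v y a b = hess v y b a := fun y hy a b =>
    hess_symm hΩ (hv.of_le (by norm_num)) hy a b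
  -- symmetry of the third and fourth derivatives
  have hT : ∀ a b c, ∀ y ∈ Ω, partialD c (fun y => hess v y a b) y
      = partialD b (fun y => hess v y a c) y := fun a b c y hy =>
    partialD_comm hΩ c b ((hp3 a).of_le (by norm_num)) hy
  have hT' : ∀ a b c, ∀ y ∈ Ω, partialD c (fun y => hess v y a b) y
      = partialD c (fun y => hess v y b a) y := fun a b c y hy =>
    dirD_congr hΩ (fun y hy => hsymm y hy a b) hy
  have hU : ∀ a b c d, ∀ y ∈ Ω, partialD d (partialD c fun y => hess v y a b) y
      = partialD d (partialD b fun y => hess v y a c) y := fun a b c d y hy =>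
    dirD_congr hΩ (hT a b c) hy
  have hU' : ∀ a b c d, ∀ y ∈ Ω, partialD d (partialD c fun y => hess v y a b) y
      = partialD d (partialD c fun y => hess v y b a) y := fun a b c d y hy =>
    dirD_congr hΩ (hT' a b c) hy
  have hU'' : ∀ a b c d, ∀ y ∈ Ω, partialD d (partialD c fun y => hess v y a b) y
      = partialD c (partialD d fun y => hess v y a b) y := fun a b c d y hy =>
    partialD_comm hΩ d c (hW2 a b) hy
  -- Full symmetry of the fourth derivatives, assembled from transpositions. It turns ξᵀW_{ij}ξ into
  -- a second derivative of v_{ij} along ξ.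
  have hUsw : ∀ a b c d, partialD d (partialD c fun y => hess v y a b) x
      = partialD b (partialD a fun y => hess v y c d) x := by
    intro a b c d
    rw [hU a b c d x hxΩ, hU'' a c b d x hxΩ, hU a c d b x hxΩ, hU' a d c b x hxΩ,
      hU d a c b x hxΩ, hU' d c a b x hxΩ]
  obtain ⟨g1, g2, g3⟩ := partialD_schur hO (W := fun a b y => hess v y a b) m
    (fun a b => (hW2 a b).mono hOΩ) hξ hs (fun a b y hy => hsymm y (hOΩ hy) a b) hWξ hξm
  -- The field ξ is frozen at x, so differentiating along ζ twice produces no derivatives of ξ.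
  let ζ : E4 := WithLp.toLp 2 fun a => ξ a x
  set S : Matrix (Fin 4) (Fin 4) ℝ :=
    Matrix.of fun a b => ∑ c, ξ c x * partialD c (fun y => hess v y a b) x with hSdef
  have hSζ : (Matrix.of fun i j => dirD ζ (fun y => hess v y i j) x) = S := by
    ext a b
    simp only [Matrix.of_apply, hSdef, dirD_eq_sum]
    rfl
  set u : Fin 4 → ℝ := Pi.single m 1 with hu
  have hyζ : dirD ζ v x = ∑ c, ξ c x * partialD c v x := dirD_eq_sum ζ v x
  -- The derivative of ∇v along ζ is Wξ = s·e_m: the gradient terms in the differentiated equation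
  -- are therefore errors of order s.
  have hpζ : (fun i => dirD ζ (fun y => grad v y i) x) = s x • u := by
    ext i
    rw [Pi.smul_apply, smul_eq_mul, ← hWξ i x hx, dirD_eq_sum]
    exact Finset.sum_congr rfl fun b _ => mul_comm _ _
  have hyyζ : dirD ζ (dirD ζ v) x = s x := by
    rw [dirD_dirD_eq_sum hΩ (hv.of_le (by norm_num)) hxΩ]
    have : ∀ i, ∑ j, ζ i * ζ j * partialD j (partialD i v) x
        = ξ i x * ∑ j, hess v x i j * ξ j x := fun i => by
      rw [Finset.mul_sum]
      exact Finset.sum_congr rfl fun j _ => by simp only [hess, Matrix.of_apply, ζ]; ring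
    simp only [this, hWξ _ x hx]
    simp [hu, Pi.single_apply, hξm x hx]
  have hppζ : (fun i => dirD ζ (dirD ζ fun y => grad v y i) x) = fun i => partialD i s x := by
    ext i
    change dirD ζ (dirD ζ (partialD i v)) x = _
    rw [dirD_dirD_eq_sum hΩ ((hp3 i).of_le (by norm_num)) hxΩ, g2 i x hx]
    refine Finset.sum_congr rfl fun a _ => Finset.sum_congr rfl fun b _ => ?_
    rw [hT' a b i x hxΩ, hT b a i x hxΩ, hT' b i a x hxΩ, hT i b a x hxΩ]
    rfl
  set V : Matrix (Fin 4) (Fin 4) ℝ :=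
    Matrix.of fun i j => dirD ζ (dirD ζ fun y => hess v y i j) x with hVdef
  let N : Matrix (Fin 4) (Fin 4) ℝ := Matrix.of fun b i => partialD i (ξ b) x
  have hVs : ∀ i j, hess s x i j = (V - 2 • (N.transpose * hess v x * N)) i j := by
    intro i j
    rw [Matrix.sub_apply, Matrix.smul_apply, nsmul_eq_mul, Nat.cast_ofNat]
    refine (g3 i j x hx).trans ?_
    congr 1
    · rw [hVdef, Matrix.of_apply, dirD_dirD_eq_sum hΩ (hW2 i j) hxΩ]
      refine Finset.sum_congr rfl fun a _ => Finset.sum_congr rfl fun b _ => ?_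
      rw [hUsw a b i j]
    · simp only [Matrix.mul_apply, Matrix.transpose_apply, Finset.sum_mul]
      rw [Finset.sum_comm]
      rfl
  -- Symmetry of the third derivatives identifies (∂_iW)ξ with column i of the derivative of W along
  -- ζ.
  have hWN : hess v x * N = Matrix.vecMulVec u (fun j => partialD j s x) - S := by
    ext a i
    rw [Matrix.mul_apply, Matrix.sub_apply, Matrix.vecMulVec_apply]
    refine (g1 i a x hx).trans ?_
    congr 1
    simp only [hSdef, Matrix.of_apply]
    exact Finset.sum_congr rfl fun b _ => by rw [hT a b i x hxΩ, mul_comm]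
  have hSs : ∀ i j, S i j = S j i := fun i j => by
    simp only [hSdef, Matrix.of_apply]
    exact Finset.sum_congr rfl fun c _ => by rw [hT' i j c x hxΩ]
  have hm1 : ∀ y ∈ Ω, hdet (mform (hess v y) (grad v y) (v y)) = 1 := fun y hy => by
    have := hsol y hy
    rw [F_eq_hdet (hsymm y hy)] at this
    linarith
  have hg2 : ∀ i, ContDiffOn ℝ 2 (fun y => grad v y i) Ω := fun i => (hp3 i).of_le (by norm_num)
  have hv2 : ContDiffOn ℝ 2 v Ω := hv.of_le (by norm_num)
  obtain ⟨k1, k2⟩ := dirD_hdet_eq_zero hΩ ζ (contDiffOn_mform hW2 hg2 hv2) hm1 x hxΩ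
  obtain ⟨l1, l2⟩ := dirD_mform hΩ ζ hW2 hg2 hv2 hxΩ
  rw [hSζ, hyζ, hpζ] at l1 l2
  rw [hyyζ, hppζ] at l2
  have ho1 : outer (grad v x) (s x • u) = s x • outer (grad v x) u := by
    ext k
    fin_cases k <;> simp [outer] <;> ring
  have ho2 : outer (s x • u) (s x • u) = (s x ^ 2) • outer u u := by
    ext k
    fin_cases k <;> simp [outer] <;> ring
  rw [ho1, smul_smul] at l1
  rw [ho2, smul_smul] at l2
  rw [l1] at k1 k2
  rw [l2] at k2
  have hmain := weighted_hess_le (N := N) (V := V) (hess_posSemidef hΩ hv2 hconv hxΩ) hSs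
    (hm1 x hxΩ) hX k1 k2 hWN
  have hcoeff : ∀ i j, coeff v i j x
      = coeffMat (v x) (mform (hess v x) (grad v x) (v x)) i j := fun i j =>
    dF_eq_coeffMat (hsymm x hxΩ) _ _ i j
  simp only [hcoeff, hVs]
  exact hmain

/-! ### Positive semidefinite matrices of rank three -/

lemma exists_ker_generator {W : Matrix (Fin 4) (Fin 4) ℝ} (hr : W.rank = 3) :
    ∃ n : Fin 4 → ℝ, n ≠ 0 ∧ W.mulVec n = 0 ∧ ∀ w, W.mulVec w = 0 → ∃ c : ℝ, c • n = w := by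
  have h := LinearMap.finrank_range_add_finrank_ker W.mulVecLin
  rw [← Matrix.rank, hr] at h
  have h1 : Module.finrank ℝ (LinearMap.ker W.mulVecLin) = 1 := by
    simp at h
    omega
  obtain ⟨⟨n, hn⟩, hn0, hspan⟩ := finrank_eq_one_iff'.mp h1
  refine ⟨n, fun h => hn0 (Subtype.ext h), by simpa using hn, fun w hw => ?_⟩
  obtain ⟨c, hc⟩ := hspan ⟨w, by simpa using hw⟩
  exact ⟨c, congrArg Subtype.val hc⟩

lemma det_add_single {W : Matrix (Fin 4) (Fin 4) ℝ} (m : Fin 4) :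
    (W + Matrix.single m m 1).det = W.det + W.adjugate m m := by
  have h : W + Matrix.single m m 1 = W.updateRow m (W m + Pi.single m 1) := by
    ext i j
    by_cases hi : i = m
    · subst hi
      simp [Matrix.single_apply, Pi.single_apply, eq_comm]
    · simp [hi, Ne.symm hi]
  rw [h, Matrix.det_updateRow_add, Matrix.updateRow_eq_self, Matrix.adjugate_apply]

/-- Choose m with n_m ≠ 0 for a kernel generator n. Adding the square of the m-th coordinate makes W
positive definite, and since det W = 0 the determinant of the sum is exactly this cofactor. -/
lemma exists_adjugate_diag_pos {W : Matrix (Fin 4) (Fin 4) ℝ} (hW : W.PosSemidef)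
    (hr : W.rank = 3) : ∃ m, 0 < W.adjugate m m := by
  obtain ⟨n, hn0, hn, hker⟩ := exists_ker_generator hr
  obtain ⟨m, hm⟩ := Function.ne_iff.mp hn0
  have hdet : W.det = 0 := Matrix.exists_mulVec_eq_zero_iff.mp ⟨n, hn0, hn⟩
  refine ⟨m, ?_⟩
  have hpd : (W + Matrix.single m m 1).PosDef := by
    refine Matrix.PosDef.of_dotProduct_mulVec_pos (hW.1.add ?_) fun x hx => ?_
    · ext i j
      simp [Matrix.single_apply, and_comm]
    · have h1 := hW.dotProduct_mulVec_nonneg x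
      have h2 : star x ⬝ᵥ ((W + Matrix.single m m 1).mulVec x)
          = star x ⬝ᵥ (W.mulVec x) + x m ^ 2 := by
        rw [Matrix.add_mulVec, dotProduct_add, Matrix.single_mulVec]
        simp [dotProduct, Function.update_apply, sq]
      rw [h2]
      refine lt_of_le_of_ne (by positivity) fun h0 => hx ?_
      have h3 : star x ⬝ᵥ (W.mulVec x) = 0 := by nlinarith [sq_nonneg (x m)]
      have h4 : x m = 0 := by
        rw [h3, zero_add] at h0
        exact pow_eq_zero_iff (two_ne_zero) |>.mp h0.symm
      obtain ⟨c, rfl⟩ := hker x ((hW.dotProduct_mulVec_zero_iff x).mp h3)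
      have hc : c = 0 := (mul_eq_zero.mp h4).resolve_right hm
      simp [hc]
  have := hpd.det_pos
  rwa [det_add_single, hdet, zero_add] at this

/-- The Hermitian part of W is W averaged with its rotation by the complex structure J. If the
average is degenerate at b, then b and Jb both lie in the kernel of W, a real line; J has no real
eigenvector, so b = 0. -/
lemma hdet_herm_pos {W : Matrix (Fin 4) (Fin 4) ℝ} (hW : W.PosSemidef) (hr : W.rank = 3) :
    0 < hdet (herm W) := by
  obtain ⟨n, -, -, hker⟩ := exists_ker_generator hr
  have hs : ∀ i j, W i j = W j i := fun i j => by simpa using (hW.1.apply i j).symm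
  by_contra hneg
  rw [not_lt] at hneg
  -- the complex structure maps `b` to `![-b 2, -b 3, b 0, b 1]`
  have hq : ∀ b : Fin 4 → ℝ, b ⬝ᵥ (W.mulVec b)
      + ![-b 2, -b 3, b 0, b 1] ⬝ᵥ (W.mulVec ![-b 2, -b 3, b 0, b 1])
      = herm W 0 * (b 0 ^ 2 + b 2 ^ 2) + herm W 1 * (b 1 ^ 2 + b 3 ^ 2)
        + 2 * herm W 2 * (b 0 * b 1 + b 2 * b 3) + 2 * herm W 3 * (b 0 * b 3 - b 1 * b 2) := by
    intro b
    simp only [dotProduct, Matrix.mulVec, Fin.sum_univ_four, herm, Matrix.cons_val]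
    rw [hs 1 0, hs 3 2, hs 3 0, hs 2 1, hs 2 0, hs 3 1]
    ring
  have hb : ∀ b : Fin 4 → ℝ, b ⬝ᵥ (W.mulVec b)
      + ![-b 2, -b 3, b 0, b 1] ⬝ᵥ (W.mulVec ![-b 2, -b 3, b 0, b 1]) ≤ 0 → b = 0 := by
    intro b hle
    have p1 := hW.dotProduct_mulVec_nonneg b
    have p2 := hW.dotProduct_mulVec_nonneg ![-b 2, -b 3, b 0, b 1]
    obtain ⟨c, hc⟩ := hker b ((hW.dotProduct_mulVec_zero_iff b).mp (by
      simp only [star_trivial] at *; linarith))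
    obtain ⟨c', hc'⟩ := hker _ ((hW.dotProduct_mulVec_zero_iff ![-b 2, -b 3, b 0, b 1]).mp (by
      simp only [star_trivial] at *; linarith))
    have e0 := congrFun hc 0
    have e1 := congrFun hc 1
    have e2 := congrFun hc 2
    have e3 := congrFun hc 3
    have f0 := congrFun hc' 0
    have f1 := congrFun hc' 1
    have f2 := congrFun hc' 2
    have f3 := congrFun hc' 3
    simp only [Pi.smul_apply, smul_eq_mul, Matrix.cons_val] at e0 e1 e2 e3 f0 f1 f2 f3
    have h02 : b 0 * b 0 + b 2 * b 2 = 0 := by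
      have : b 0 * b 0 = b 2 * (-b 2) := by
        rw [← f0]; nth_rewrite 2 [← f2]; rw [← e0, ← e2]; ring
      linarith
    have h13 : b 1 * b 1 + b 3 * b 3 = 0 := by
      have : b 1 * b 1 = b 3 * (-b 3) := by
        rw [← f1]; nth_rewrite 2 [← f3]; rw [← e1, ← e3]; ring
      linarith
    have z0 : b 0 = 0 := mul_self_eq_zero.mp
      (by linarith [mul_self_nonneg (b 0), mul_self_nonneg (b 2)])
    have z1 : b 1 = 0 := mul_self_eq_zero.mp
      (by linarith [mul_self_nonneg (b 1), mul_self_nonneg (b 3)])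
    have z2 : b 2 = 0 := mul_self_eq_zero.mp
      (by linarith [mul_self_nonneg (b 2), mul_self_nonneg (b 0)])
    have z3 : b 3 = 0 := mul_self_eq_zero.mp
      (by linarith [mul_self_nonneg (b 3), mul_self_nonneg (b 1)])
    ext i
    fin_cases i
    exacts [z0, z1, z2, z3]
  have hX0 : 0 < herm W 0 := by
    by_contra h0
    have := hb (Pi.single 0 1) (by rw [hq]; simpa using h0)
    simpa using congrFun this 0
  -- On this vector the averaged form equals X₀·det X, which is nonpositive under the contrary
  -- assumption, while its second entry X₀ is positive.
  have := hb ![-herm W 2, herm W 0, herm W 3, 0] (by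
    rw [hq]
    simp only [Matrix.cons_val]
    have := mul_nonpos_of_nonneg_of_nonpos hX0.le hneg
    simp only [hdet] at this
    linarith)
  have h1 := congrFun this 1
  simp only [Matrix.cons_val, Pi.zero_apply] at h1
  exact hX0.ne' h1

/-! ### Regularity and continuity of the coefficients -/

lemma contDiffOn_det {Ω : Set E4} {n : WithTop ℕ∞} {A : E4 → Matrix (Fin 4) (Fin 4) ℝ}
    (hA : ∀ i j, ContDiffOn ℝ n (fun y => A y i j) Ω) : ContDiffOn ℝ n (fun y => (A y).det) Ω := by
  simp only [Matrix.det_apply']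
  exact ContDiffOn.sum fun σ _ => contDiffOn_const.mul (contDiffOn_prod fun i _ => hA _ _)

lemma contDiffOn_adjugate {Ω : Set E4} {n : WithTop ℕ∞} {A : E4 → Matrix (Fin 4) (Fin 4) ℝ}
    (hA : ∀ i j, ContDiffOn ℝ n (fun y => A y i j) Ω) (i j : Fin 4) :
    ContDiffOn ℝ n (fun y => (A y).adjugate i j) Ω := by
  simp only [Matrix.adjugate_apply]
  refine contDiffOn_det fun a b => ?_
  by_cases h : a = j
  · subst h
    simpa using contDiffOn_const
  · simpa [h] using hA a b

section Continuity

variable {X : Type*} [TopologicalSpace X] {x : X}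

@[fun_prop]
lemma continuousAt_herm {A : X → Matrix (Fin 4) (Fin 4) ℝ} (hA : ContinuousAt A x) :
    ContinuousAt (fun y => herm (A y)) x := by
  have hA' : ∀ i j, ContinuousAt (fun y => A y i j) x := fun i j =>
    continuousAt_pi.mp (continuousAt_pi.mp hA i) j
  refine continuousAt_pi.mpr fun k => ?_
  fin_cases k <;> simp [herm] <;> fun_prop (disch := norm_num)

@[fun_prop]
lemma continuousAt_outer {p q : X → Fin 4 → ℝ} (hp : ContinuousAt p x) (hq : ContinuousAt q x) :
    ContinuousAt (fun y => outer (p y) (q y)) x := by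
  have hp' : ∀ i, ContinuousAt (fun y => p y i) x := continuousAt_pi.mp hp
  have hq' : ∀ i, ContinuousAt (fun y => q y i) x := continuousAt_pi.mp hq
  refine continuousAt_pi.mpr fun k => ?_
  fin_cases k <;> simp [outer] <;> fun_prop (disch := norm_num)

@[fun_prop]
lemma continuousAt_hdet {p : X → Fin 4 → ℝ} (hp : ContinuousAt p x) :
    ContinuousAt (fun y => hdet (p y)) x := by
  have hp' : ∀ i, ContinuousAt (fun y => p y i) x := continuousAt_pi.mp hp
  simp only [hdet]
  fun_prop

@[fun_prop]
lemma continuousAt_hpol {p q : X → Fin 4 → ℝ} (hp : ContinuousAt p x) (hq : ContinuousAt q x) :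
    ContinuousAt (fun y => hpol (p y) (q y)) x := by
  have hp' : ∀ i, ContinuousAt (fun y => p y i) x := continuousAt_pi.mp hp
  have hq' : ∀ i, ContinuousAt (fun y => q y i) x := continuousAt_pi.mp hq
  simp only [hpol]
  fun_prop

@[fun_prop]
lemma continuousAt_mform {A : X → Matrix (Fin 4) (Fin 4) ℝ} {p : X → Fin 4 → ℝ} {z : X → ℝ}
    (hA : ContinuousAt A x) (hp : ContinuousAt p x) (hz : ContinuousAt z x) :
    ContinuousAt (fun y => mform (A y) (p y) (z y)) x := by
  simp only [mform]
  fun_prop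

@[fun_prop]
lemma continuousAt_coeffMat {z : X → ℝ} {m : X → Fin 4 → ℝ} (hz : ContinuousAt z x)
    (hm : ContinuousAt m x) (i j : Fin 4) :
    ContinuousAt (fun y => coeffMat (z y) (m y) i j) x := by
  have hm' : ∀ i, ContinuousAt (fun y => m y i) x := continuousAt_pi.mp hm
  fin_cases i <;> fin_cases j <;> simp [coeffMat] <;> fun_prop

@[fun_prop]
lemma continuousAt_adjMulMat {p q : X → Fin 4 → ℝ} (hp : ContinuousAt p x)
    (hq : ContinuousAt q x) (i j : Fin 4) :
    ContinuousAt (fun y => adjMulMat (p y) (q y) i j) x := by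
  have hp' : ∀ i, ContinuousAt (fun y => p y i) x := continuousAt_pi.mp hp
  have hq' : ∀ i, ContinuousAt (fun y => q y i) x := continuousAt_pi.mp hq
  fin_cases i <;> fin_cases j <;> simp [adjMulMat] <;> fun_prop

lemma continuousAt_errCoeff {W S : X → Matrix (Fin 4) (Fin 4) ℝ} {p : X → Fin 4 → ℝ}
    {z y s : X → ℝ} (u : Fin 4 → ℝ) (hW : ContinuousAt W x) (hS : ContinuousAt S x)
    (hp : ContinuousAt p x) (hz : ContinuousAt z x) (hy : ContinuousAt y x)
    (hs : ContinuousAt s x) :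
    ContinuousAt (fun t => errCoeff (W t) (S t) (p t) u (z t) (y t) (s t)) x := by
  simp only [errCoeff]
  fun_prop

lemma continuousAt_errGradCoeff {W S : X → Matrix (Fin 4) (Fin 4) ℝ} {p : X → Fin 4 → ℝ}
    {z : X → ℝ} (u : Fin 4 → ℝ) (hW : ContinuousAt W x) (hS : ContinuousAt S x)
    (hp : ContinuousAt p x) (hz : ContinuousAt z x) (j : Fin 4) :
    ContinuousAt (fun t => errGradCoeff (W t) (S t) (p t) u (z t) j) x := by
  simp only [errGradCoeff]
  fun_prop

end Continuity

/-! ### Passing from the Schur complement to the determinant -/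

lemma hess_mul {O : Set E4} (hO : IsOpen O) {f s d : E4 → ℝ} (hs : ContDiffOn ℝ 2 s O)
    (hd : ContDiffOn ℝ 2 d O) (hf : ∀ y ∈ O, f y = d y * s y) {x : E4} (hx : x ∈ O) :
    (∀ i, partialD i f x = partialD i d x * s x + d x * partialD i s x) ∧
    ∀ i j, hess f x i j = hess d x i j * s x + partialD i d x * partialD j s x
      + partialD j d x * partialD i s x + d x * hess s x i j := by
  have d1 : ∀ {g : E4 → ℝ}, ContDiffOn ℝ 2 g O → ∀ y ∈ O, DifferentiableAt ℝ g y :=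
    fun hg y hy => differentiableAt_of_contDiffOn hO hg (by norm_num) hy
  have d2 : ∀ {g : E4 → ℝ}, ContDiffOn ℝ 2 g O → ∀ i, DifferentiableAt ℝ (partialD i g) x :=
    fun hg i => differentiableAt_of_contDiffOn hO
      (contDiffOn_partialD hO i hg (m := 1) (by norm_num)) (by norm_num) hx
  have h1 : ∀ i, ∀ y ∈ O, partialD i f y = partialD i d y * s y + d y * partialD i s y := by
    intro i y hy
    rw [partialD_eq_dirD, dirD_congr hO hf hy, dirD_mul (d1 hd y hy) (d1 hs y hy)]
    rfl
  refine ⟨fun i => h1 i x hx, fun i j => ?_⟩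
  change partialD j (partialD i f) x = _
  have a1 := d1 hd x hx
  have a2 := d1 hs x hx
  have a3 := d2 hd i
  have a4 := d2 hs i
  rw [partialD_eq_dirD, dirD_congr hO (h1 i) hx, dirD_add (a3.fun_mul a2) (a1.fun_mul a4),
    dirD_mul a3 a2, dirD_mul a1 a4]
  simp only [hess, Matrix.of_apply, partialD_eq_dirD]
  ring

lemma abs_partialD_le_norm_gradient (i : Fin 4) (f : E4 → ℝ) (x : E4) :
    |partialD i f x| ≤ ‖gradient f x‖ := by
  have h := (fderiv ℝ f x).le_opNorm (EuclideanSpace.single i 1)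
  have h2 : ‖gradient f x‖ = ‖fderiv ℝ f x‖ := by
    simp [gradient]
  rw [h2]
  simpa [partialD] using h

end PowerConvexity

end

theorem theorem3p2 (Ω : Set (EuclideanSpace ℝ (Fin 4))) (hΩ : IsOpen Ω) (hΩc : IsConnected Ω)
    (v : EuclideanSpace ℝ (Fin 4) → ℝ) (hv : ContDiffOn ℝ 4 v Ω)
    (hconv : PowerConvexity.IsConvexFunction Ω v) (hsol : PowerConvexity.IsSolution Ω v)
    (x₀ : EuclideanSpace ℝ (Fin 4)) (hx₀ : x₀ ∈ Ω)
    (hrank : (PowerConvexity.hess v x₀).rank = 3)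
    (hmin : ∀ x ∈ Ω, 3 ≤ (PowerConvexity.hess v x).rank) :
    ∃ O : Set (EuclideanSpace ℝ (Fin 4)), IsOpen O ∧ x₀ ∈ O ∧ O ⊆ Ω ∧
      ∃ C : ℝ, 0 < C ∧ ∀ x ∈ O,
        ∑ i : Fin 4, ∑ j : Fin 4,
            PowerConvexity.coeff v i j x
              * PowerConvexity.hess (PowerConvexity.phi v) x i j
          ≤ C * (PowerConvexity.phi v x + ‖gradient (PowerConvexity.phi v) x‖) := by
  open PowerConvexity in
  have hv2 : ContDiffOn ℝ 2 v Ω := hv.of_le (by norm_num)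
  have hp3 : ∀ k, ContDiffOn ℝ 3 (partialD k v) Ω := fun k =>
    contDiffOn_partialD hΩ k hv (by norm_num)
  have hW2 : ∀ a b, ContDiffOn ℝ 2 (fun y => hess v y a b) Ω := fun a b =>
    contDiffOn_partialD hΩ b (hp3 a) (by norm_num)
  have hsymm : ∀ y ∈ Ω, ∀ a b, hess v y a b = hess v y b a := fun y hy a b =>
    hess_symm hΩ hv2 hy a b
  have hpsd : ∀ y ∈ Ω, (hess v y).PosSemidef := fun y hy => hess_posSemidef hΩ hv2 hconv hy
  obtain ⟨m, hm⟩ := exists_adjugate_diag_pos (hpsd x₀ hx₀) hrank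
  have hX := hdet_herm_pos (hpsd x₀ hx₀) hrank
  have cont : ∀ {f : E4 → ℝ} {n : WithTop ℕ∞} {U : Set E4}, IsOpen U → x₀ ∈ U →
      ContDiffOn ℝ n f U → ContinuousAt f x₀ := fun hU hx hf =>
    hf.continuousOn.continuousAt (hU.mem_nhds hx)
  have cW : ContinuousAt (hess v) x₀ := continuousAt_pi.mpr fun a => continuousAt_pi.mpr fun b =>
    cont hΩ hx₀ (hW2 a b)
  have cp : ContinuousAt (grad v) x₀ := continuousAt_pi.mpr fun a => cont hΩ hx₀ (hp3 a)
  have cv : ContinuousAt v x₀ := cont hΩ hx₀ hv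
  set d : E4 → ℝ := fun y => (hess v y).adjugate m m with hd
  have hdΩ : ContDiffOn ℝ 2 d Ω := contDiffOn_adjugate hW2 m m
  have hev : ∀ᶠ y in nhds x₀, y ∈ Ω ∧ 0 < d y ∧ 0 < hdet (herm (hess v y)) :=
    Filter.Eventually.and (hΩ.mem_nhds hx₀)
      (((cont hΩ hx₀ hdΩ).eventually (lt_mem_nhds hm)).and
        ((continuousAt_hdet (continuousAt_herm cW)).eventually (lt_mem_nhds hX)))
  obtain ⟨O, hOsub, hO, hx₀O⟩ := eventually_nhds_iff.mp hev
  have hOΩ : O ⊆ Ω := fun y hy => (hOsub y hy).1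
  have hd0 : ∀ y ∈ O, d y ≠ 0 := fun y hy => (hOsub y hy).2.1.ne'
  have hdO : ContDiffOn ℝ 2 d O := hdΩ.mono hOΩ
  set s : E4 → ℝ := fun y => phi v y / d y with hs
  -- A normalized column of the adjugate: W·adj W = det W·I gives Wξ = (φ/d)·e_m, and division by d
  -- makes ξ_m = 1.
  let ξ : Fin 4 → E4 → ℝ := fun a y => (hess v y).adjugate a m / d y
  have hsO : ContDiffOn ℝ 2 s O := ((contDiffOn_det hW2).mono hOΩ).div hdO hd0
  have hξO : ∀ a, ContDiffOn ℝ 2 (ξ a) O := fun a =>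
    ((contDiffOn_adjugate hW2 a m).mono hOΩ).div hdO hd0
  have hWξ : ∀ a, ∀ y ∈ O, ∑ b, hess v y a b * ξ b y
      = s y * (Pi.single m 1 : Fin 4 → ℝ) a := by
    intro a y hy
    have h := congrFun (congrFun (Matrix.mul_adjugate (hess v y)) a) m
    rw [Matrix.mul_apply] at h
    simp only [ξ, mul_div_assoc', ← Finset.sum_div, h, hs, phi]
    simp [Matrix.one_apply, Pi.single_apply]
    split_ifs <;> ring
  have hξm : ∀ y ∈ O, ξ m y = 1 := fun y hy => div_self (hd0 y hy)
  have hm1 : ∀ y ∈ Ω, hdet (mform (hess v y) (grad v y) (v y)) = 1 := fun y hy => by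
    have := hsol y hy
    rw [F_eq_hdet (hsymm y hy)] at this
    linarith
  have hv0 : ∀ y ∈ O, v y ≠ 0 := by
    intro y hy h0
    have hXy := (hOsub y hy).2.2
    have hX0 : 0 ≤ herm (hess v y) 0 := by
      have := add_nonneg ((hpsd y (hOΩ hy)).diag_nonneg (i := 0))
        ((hpsd y (hOΩ hy)).diag_nonneg (i := 2))
      simpa [herm] using this
    have := mul_mform_zero_pos (hm1 y (hOΩ hy)) hXy hX0
    simp [h0] at this
  have hcoeff : ∀ y ∈ Ω, ∀ i j, coeff v i j y
      = coeffMat (v y) (mform (hess v y) (grad v y) (v y)) i j := fun y hy i j =>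
    dF_eq_coeffMat (hsymm y hy) _ _ i j
  let S : E4 → Matrix (Fin 4) (Fin 4) ℝ := fun x =>
    Matrix.of fun a b => ∑ c, ξ c x * partialD c (fun y => hess v y a b) x
  let α : E4 → ℝ := fun x => errCoeff (hess v x) (S x) (grad v x) (Pi.single m 1) (v x)
    (∑ c, ξ c x * partialD c v x) (s x)
  let β : Fin 4 → E4 → ℝ := fun j x =>
    errGradCoeff (hess v x) (S x) (grad v x) (Pi.single m 1) (v x) j
  let κ : E4 → ℝ := fun x => v x ^ 2 * hdet (herm (hess v x))
  have hκ : ∀ y ∈ O, 0 < κ y := fun y hy =>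
    mul_pos (by have := hv0 y hy; positivity) (hOsub y hy).2.2
  let a : Fin 4 → Fin 4 → E4 → ℝ := fun i j x =>
    coeffMat (v x) (mform (hess v x) (grad v x) (v x)) i j
  -- `A` and `B` bound F^{ij}φ_{ij} in terms of s and ∇s, by the product rule for φ = d·s. `A'` and
  -- `B'` express the same bound through φ and ∇φ, using ∇s = ∇φ/d − φ∇d/d².
  let A : E4 → ℝ := fun x => d x / κ x * α x + ∑ i, ∑ j, a i j x * hess d x i j
  let B : Fin 4 → E4 → ℝ := fun j x => d x / κ x * β j x + 2 * ∑ i, a i j x * partialD i d x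
  let A' : E4 → ℝ := fun x => A x / d x - ∑ j, B j x * partialD j d x / d x ^ 2
  let B' : Fin 4 → E4 → ℝ := fun j x => B j x / d x
  -- the differential inequality with explicit continuous coefficients
  have hineq : ∀ x ∈ O, ∑ i, ∑ j, coeff v i j x * hess (phi v) x i j
      ≤ A' x * phi v x + ∑ j, B' j x * partialD j (phi v) x := by
    intro x hx
    have hK := weighted_hess_schur_le hΩ hv hconv hsol hO hOΩ m hξO hsO hWξ hξm hx
      (hOsub x hx).2.2
    obtain ⟨q1, q2⟩ := hess_mul hO hsO hdO (f := phi v)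
      (fun y hy => by rw [hs]; field_simp [hd0 y hy]) hx
    have hφ : phi v x = d x * s x := by
      rw [hs]; field_simp [hd0 x hx]
    have hdx := hd0 x hx
    have hdp := (hOsub x hx).2.1
    have hκx := hκ x hx
    have e1 : A' x * phi v x + ∑ j, B' j x * partialD j (phi v) x
        = A x * s x + ∑ j, B j x * partialD j s x := by
      simp only [A', B', q1, hφ]
      have : ∀ j, B j x / d x * (partialD j d x * s x + d x * partialD j s x)
          = B j x * partialD j d x / d x ^ 2 * (d x * s x) + B j x * partialD j s x := by
        intro j
        field_simp
      simp only [this, Finset.sum_add_distrib, ← Finset.sum_mul]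
      field_simp
      ring
    rw [e1]
    simp only [hcoeff x (hOΩ hx)] at hK ⊢
    have hK2 : ∑ i, ∑ j, a i j x * hess s x i j
        ≤ (α x * s x + ∑ j, β j x * partialD j s x) / κ x := by
      rw [le_div_iff₀ hκx, mul_comm]
      exact hK
    have e2 : ∑ i, ∑ j, a i j x * hess (phi v) x i j
        = (∑ i, ∑ j, a i j x * hess d x i j) * s x
          + ∑ j, (2 * ∑ i, a i j x * partialD i d x) * partialD j s x
          + d x * ∑ i, ∑ j, a i j x * hess s x i j := by
      -- The two mixed gradient terms of the product rule agree because the coefficient matrix is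
      -- symmetric.
      have e3 : ∑ j, (2 * ∑ i, a i j x * partialD i d x) * partialD j s x
          = ∑ i, ∑ j, a i j x * (partialD i d x * partialD j s x)
            + ∑ i, ∑ j, a i j x * (partialD j d x * partialD i s x) := by
        have e4 : ∑ i, ∑ j, a i j x * (partialD j d x * partialD i s x)
            = ∑ j, ∑ i, a i j x * (partialD i d x * partialD j s x) :=
          Finset.sum_congr rfl fun i _ => Finset.sum_congr rfl fun j _ => by
            rw [show a i j x = a j i x from coeffMat_comm _ _ i j]
        rw [e4, Finset.sum_comm, ← Finset.sum_add_distrib]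
        refine Finset.sum_congr rfl fun j _ => ?_
        rw [Finset.mul_sum, Finset.sum_mul, ← Finset.sum_add_distrib]
        exact Finset.sum_congr rfl fun i _ => by ring
      rw [e3]
      simp only [q2, mul_add, Finset.sum_add_distrib, Finset.sum_mul, Finset.mul_sum]
      have e5 : ∀ i j, a i j x * (d x * hess s x i j) = d x * (a i j x * hess s x i j) :=
        fun i j => by ring
      simp only [e5, mul_assoc]
      ring
    calc ∑ i, ∑ j, a i j x * hess (phi v) x i j
        ≤ (∑ i, ∑ j, a i j x * hess d x i j) * s x
          + ∑ j, (2 * ∑ i, a i j x * partialD i d x) * partialD j s x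
          + d x * ((α x * s x + ∑ j, β j x * partialD j s x) / κ x) := by
          rw [e2]
          gcongr
      _ = A x * s x + ∑ j, B j x * partialD j s x := by
          simp only [A, B, add_mul, Finset.sum_add_distrib, mul_assoc, ← Finset.mul_sum]
          ring
  -- continuity of the coefficients
  have cd : ContinuousAt d x₀ := cont hO hx₀O hdO
  have cs : ContinuousAt s x₀ := cont hO hx₀O hsO
  have cξ : ∀ c, ContinuousAt (ξ c) x₀ := fun c => cont hO hx₀O (hξO c)
  have cd1 : ∀ j, ContDiffOn ℝ 1 (partialD j d) O := fun j =>
    contDiffOn_partialD hO j hdO (by norm_num)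
  have cdj : ∀ j, ContinuousAt (partialD j d) x₀ := fun j => cont hO hx₀O (cd1 j)
  have chd : ∀ i j, ContinuousAt (fun x => hess d x i j) x₀ := fun i j =>
    cont hO hx₀O (contDiffOn_partialD hO j (cd1 i) (m := 0) (by norm_num))
  have cWc : ∀ a b c, ContinuousAt (partialD c fun y => hess v y a b) x₀ := fun a b c =>
    cont hΩ hx₀ (contDiffOn_partialD hΩ c (hW2 a b) (m := 1) (by norm_num))
  have cvc : ∀ c, ContinuousAt (partialD c v) x₀ := fun c => cont hΩ hx₀ (hp3 c)
  have cS : ContinuousAt S x₀ := continuousAt_pi.mpr fun a => continuousAt_pi.mpr fun b => by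
    simp only [S, Matrix.of_apply]
    fun_prop
  have cα : ContinuousAt α x₀ :=
    continuousAt_errCoeff _ cW cS cp cv (by fun_prop) cs
  have cβ : ∀ j, ContinuousAt (β j) x₀ := fun j => continuousAt_errGradCoeff _ cW cS cp cv j
  have cκ : ContinuousAt κ x₀ := by
    simp only [κ]
    fun_prop
  have ca : ∀ i j, ContinuousAt (a i j) x₀ := fun i j => by
    simp only [a]
    fun_prop
  have hκ0 := (hκ x₀ hx₀O).ne'
  have hdx₀ := hd0 x₀ hx₀O
  have cdκ : ContinuousAt (fun x => d x / κ x) x₀ := cd.div cκ hκ0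
  have cA : ContinuousAt A x₀ := by
    simp only [A]
    fun_prop
  have cB : ∀ j, ContinuousAt (B j) x₀ := fun j => by
    simp only [B]
    fun_prop
  have cB' : ∀ j, ContinuousAt (B' j) x₀ := fun j => (cB j).div cd hdx₀
  have cA' : ContinuousAt A' x₀ := by
    refine (cA.div cd hdx₀).sub (tendsto_finsetSum _ fun j _ => ?_)
    exact ((cB j).mul (cdj j)).div (cd.pow 2) (pow_ne_zero 2 hdx₀)
  -- boundedness of the coefficients near the base point
  have hbd : ∀ {f : E4 → ℝ}, ContinuousAt f x₀ → ∀ᶠ y in nhds x₀, |f y| < |f x₀| + 1 :=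
    fun hf => hf.abs.eventually (gt_mem_nhds (lt_add_one _))
  have hev2 : ∀ᶠ y in nhds x₀, y ∈ O ∧ |A' y| < |A' x₀| + 1 ∧
      ∀ j, |B' j y| < |B' j x₀| + 1 :=
    Filter.Eventually.and (hO.mem_nhds hx₀O)
      ((hbd cA').and (Filter.eventually_all.mpr fun j => hbd (cB' j)))
  obtain ⟨O', hO'sub, hO', hx₀O'⟩ := eventually_nhds_iff.mp hev2
  -- The constant adds the local bounds of all coefficients, so that φ ≥ 0 and |∇φ| ≥ 0 absorb the
  -- surplus products.
  refine ⟨O', hO', hx₀O', fun y hy => hOΩ (hO'sub y hy).1,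
    (|A' x₀| + 1) + ∑ j, (|B' j x₀| + 1), by positivity, fun x hx => ?_⟩
  obtain ⟨hxO, hAx, hBx⟩ := hO'sub x hx
  refine (hineq x hxO).trans ?_
  have hφ0 : 0 ≤ phi v x := (hpsd x (hOΩ hxO)).det_nonneg
  have hg0 : 0 ≤ ‖gradient (phi v) x‖ := norm_nonneg _
  have t1 : A' x * phi v x ≤ (|A' x₀| + 1) * phi v x :=
    mul_le_mul_of_nonneg_right ((le_abs_self _).trans hAx.le) hφ0
  have t2 : ∑ j, B' j x * partialD j (phi v) x
      ≤ (∑ j, (|B' j x₀| + 1)) * ‖gradient (phi v) x‖ := by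
    rw [Finset.sum_mul]
    refine Finset.sum_le_sum fun j _ => (le_abs_self _).trans ?_
    rw [abs_mul]
    exact mul_le_mul (hBx j).le (abs_partialD_le_norm_gradient j _ x) (abs_nonneg _)
      (by positivity)
  have t3 : 0 ≤ (∑ j, (|B' j x₀| + 1)) * phi v x := by positivity
  have t4 : 0 ≤ (|A' x₀| + 1) * ‖gradient (phi v) x‖ := by positivity
  linarith
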